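/- **Theorem 1.** Let $d\ge 1$, $\lambda>0$, let $\mu_1$ be the Cauchy distribution on $\mathbb{R}$ with density $\frac{\lambda}{\pi(x^2+\lambda^2)}$, and let $\mu_2$ be an arbitrary probability measure on $\mathbb{R}$. For a real potential $\omega=(\omega_n)_{n\in\mathbb{Z}^d}$ let $H^\omega$ be the self-adjoint operator on $\ell^2(\mathbb{Z}^d)$ given by $$(H^\omega u)(n)=\sum_{|k-n|_1=1}u(k)+\omega_n u(n),\qquad |k-n|_1=\sum_{i=1}^d|k_i-n_i|,$$ on its maximal domain, and let $H_L^\omega$ be its restriction $\chi_L H^\omega\chi_L$ to $\ell^2(\Lambda_L)$, where $\Lambda_L=\{n\in\mathbb{Z}^d:|n_i|\le L,\ 1\le i\le d\}$ and $\chi_L$ is the orthogonal projection onto $\ell^2(\Lambda_L)$. Let $(\omega_n)_{n\in\mathbb{Z}^d}$ be i.i.d. with common distribution $\mu_1*\mu_2$. Then there is exactly one measure $\nu$ on $\mathbb{R}$ (the density of states measure of $H^\omega$) such that for every $E\in\mathbb{R}$ $$\lim_{L\to\infty}\frac{\#\{j: E_j\le E\}}{(2L+1)^d}=\nu((-\infty,E])\quad\text{for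 almost every }\omega,$$ where $(E_j)_j$ are the eigenvalues of $H_L^\omega$ counted with multiplicity. It is a probability measure, and for every $t\in\mathbb{R}$ its Fourier transform is $$\hat\nu(t)=\int_{\mathbb{R}} e^{-itx}\,d\nu(x)=e^{-\lambda|t|}\;\mathbb{E}\Big(\big\langle e_0,\,e^{-ith^{\omega_2}}e_0\big\rangle\Big),$$ where $h^{\omega_2}=H^{\omega_2}$ is the operator with i.i.d. potential $\omega_2=(\omega_{2,n})_{n\in\mathbb{Z}^d}$ of common distribution $\mu_2$, $\mathbb{E}$ is the expectation over $\omega_2$ (of an integrable random variable), $e^{-ith^{\omega_2}}$ is the strongly continuous unitary group generated by $h^{\omega_2}$, and $e_0$ is the standard basis vector of $\ell^2(\mathbb{Z}^d)$ at the origin. -/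

import Mathlib

open MeasureTheory ProbabilityTheory Filter Topology
open scoped NNReal ENNReal

noncomputable section

/-! ### The unitary group generated by an unbounded operator -/

section UnitaryGroup

variable {E : Type*} [NormedAddCommGroup E] [InnerProductSpace ℂ E] [CompleteSpace E]

/-- `U` is the strongly continuous one-parameter unitary group `t ↦ exp(-itA)`: the vectors at which
the orbit `t ↦ U t x` is differentiable at `0` are exactly those of the domain of `A`, and there the
derivative is `-i A x`. -/
structure IsUnitaryGroupOf (A : E →ₗ.[ℂ] E) (U : ℝ → E →L[ℂ] E) : Prop where
  map_zero : U 0 = 1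
  map_add : ∀ s t : ℝ, U (s + t) = U s * U t
  mem_unitary : ∀ t : ℝ, U t ∈ unitary (E →L[ℂ] E)
  strongly_continuous : ∀ x : E, Continuous fun t : ℝ => U t x
  generator : ∀ x y : E,
    (x, y) ∈ A.graph ↔ HasDerivAt (fun t : ℝ => U t x) (-(Complex.I • y)) 0

open Classical in
/-- `exp(-itA)`. It is the unique unitary group generated by `A` if there is one (by Stone's theorem:
if `A` is self-adjoint), and `0` otherwise. -/
def expNegI (A : E →ₗ.[ℂ] E) : ℝ → E →L[ℂ] E :=
  if h : ∃ U : ℝ → E →L[ℂ] E, IsUnitaryGroupOf A U then h.choose else 0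

end UnitaryGroup

/-! ### The Anderson model on `ℓ²(ℤ^d)` -/

namespace Anderson

/-- The lattice `ℤ^d`. -/
abbrev Lattice (d : ℕ) : Type := Fin d → ℤ

/-- The complex Hilbert space `ℓ²(ℤ^d)`. -/
abbrev Hilb (d : ℕ) : Type := lp (fun _ : Lattice d => ℂ) 2

/-- The vector `e_n` of the standard basis. -/
def basisVec {d : ℕ} (n : Lattice d) : Hilb d := lp.single 2 n (1 : ℂ)

/-- `(Δ u)(n) + ω_n u(n)` for an arbitrary function `u` on `ℤ^d`, where `Δ` sums over the `2d`
nearest neighbours of `n`. -/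
def formalOp {d : ℕ} (ω : Lattice d → ℝ) : (Lattice d → ℂ) →ₗ[ℂ] (Lattice d → ℂ) where
  toFun u n := (∑ i : Fin d, (u (n + Pi.single i 1) + u (n - Pi.single i 1))) + (ω n : ℂ) * u n
  map_add' u v := by
    funext n
    simp only [Pi.add_apply, Finset.sum_add_distrib]
    ring
  map_smul' c u := by
    funext n
    simp only [Pi.smul_apply, smul_eq_mul, RingHom.id_apply, Finset.sum_add_distrib, mul_add,
      Finset.mul_sum]
    ring

/-- The operator `Δ + V^ω` on `ℓ²(ℤ^d)`, on its maximal domain `{u : Δ u + V^ω u ∈ ℓ²}`. As `Δ` is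
bounded, this is the domain of the multiplication operator `V^ω`. -/
def hamiltonian {d : ℕ} (ω : Lattice d → ℝ) : Hilb d →ₗ.[ℂ] Hilb d where
  domain :=
    { carrier := {u | Memℓp (formalOp ω (u : Lattice d → ℂ)) 2}
      add_mem' := fun {u v} hu hv => by
        simp only [Set.mem_ofPred_eq, lp.coeFn_add, map_add] at *
        exact hu.add hv
      zero_mem' := by
        simp only [Set.mem_ofPred_eq, lp.coeFn_zero, map_zero]
        exact zero_memℓp
      smul_mem' := fun c u hu => by
        simp only [Set.mem_ofPred_eq, lp.coeFn_smul, map_smul] at *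
        exact hu.const_smul c }
  toFun :=
    { toFun := fun u => ⟨formalOp ω ((u : Hilb d) : Lattice d → ℂ), u.2⟩
      map_add' := fun u v => Subtype.ext (map_add (formalOp ω) _ _)
      map_smul' := fun c u => Subtype.ext (map_smul (formalOp ω) c _) }

/-- The cube `Λ_L = {n ∈ ℤ^d : |n_i| ≤ L for all i}`. -/
def box (d L : ℕ) : Finset (Lattice d) :=
  Fintype.piFinset fun _ => Finset.Icc (-(L : ℤ)) (L : ℤ)

/-- The matrix of the restriction `H_L^ω = χ_L H^ω χ_L` to `ℓ²(Λ_L)`, in the standard basis. -/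
def boxMatrix {d : ℕ} (ω : Lattice d → ℝ) (L : ℕ) : Matrix (box d L) (box d L) ℂ :=
  Matrix.of fun m n => formalOp ω (Pi.single (n : Lattice d) 1) m

theorem boxMatrix_isHermitian {d : ℕ} (ω : Lattice d → ℝ) (L : ℕ) :
    (boxMatrix ω L).IsHermitian := by
  ext m n
  simp only [Matrix.conjTranspose_apply, boxMatrix, Matrix.of_apply, formalOp, LinearMap.coe_mk,
    AddHom.coe_mk, Pi.single_apply, star_add, star_sum, star_mul', RCLike.star_def,
    apply_ite (starRingEnd ℂ), map_one, map_zero, Complex.conj_ofReal]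
  congr 1
  · refine Finset.sum_congr rfl fun i _ => ?_
    rw [add_comm]
    congr 1
    · refine if_congr ?_ rfl rfl
      exact ⟨fun h => by rw [← h, sub_add_cancel], fun h => by rw [← h, add_sub_cancel_right]⟩
    · refine if_congr ?_ rfl rfl
      exact ⟨fun h => by rw [← h, add_sub_cancel_right], fun h => by rw [← h, sub_add_cancel]⟩
  · by_cases h : (n : Lattice d) = m
    · simp [h]
    · simp [h, Ne.symm h]

/-- The number of eigenvalues of `H_L^ω`, counted with multiplicity, that are at most `x`. -/
def eigenCount {d : ℕ} (ω : Lattice d → ℝ) (L : ℕ) (x : ℝ) : ℕ :=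
  (Finset.univ.filter fun j => (boxMatrix_isHermitian ω L).eigenvalues j ≤ x).card

/-- The law of an i.i.d. potential on `ℤ^d` with single-site distribution `μ`. -/
def potentialLaw (d : ℕ) (μ : Measure ℝ) [IsProbabilityMeasure μ] : Measure (Lattice d → ℝ) :=
  Measure.infinitePi fun _ : Lattice d => μ

/-- `ν` is the density of states measure of the Anderson model on `ℤ^d` with single-site
distribution `μ`: for every real `x`, the normalized eigenvalue counting functions of the boxes
converge almost surely to `ν (-∞, x]`. -/
def IsDensityOfStates (d : ℕ) (μ : Measure ℝ) [IsProbabilityMeasure μ] (ν : Measure ℝ) : Prop :=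
  ∀ x : ℝ, ∀ᵐ ω ∂(potentialLaw d μ),
    Tendsto (fun L : ℕ => (eigenCount ω L x : ℝ≥0∞) / ((2 * L + 1 : ℕ) : ℝ≥0∞) ^ d) atTop
      (𝓝 (ν (Set.Iic x)))

end Anderson

end

/-!
The density of states measure is identified through its Fourier transform, which turns the
eigenvalue counting functions into return amplitudes of the unitary evolution.

*Locality.* Hopping moves a particle by one site, and multiplication by the distance to a fixed site
commutes with the potential. Hence Duhamel's formula bounds the root mean square distance
travelled up to time `t` by `2d|t|`, uniformly in the potential and in the volume, and the evolution
of `e_c` in any `S ⊇ cube c R` differs from the one in `cube c R` by at most `(2dt)²/R`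
(`Anderson.norm_expGroup_boxOp_sub_le`). So the evolutions in the boxes converge strongly, even for
unbounded potentials. The limit is a unitary group whose generator is the Hamiltonian on its maximal
domain (`Anderson.infGroup_isUnitaryGroupOf`), and a densely defined operator generates at most one
unitary group (`IsUnitaryGroupOf.unique`).

*Self-averaging.* The Fourier transform of the normalized eigenvalue distribution of `H_L` is
`(2L+1)^{-d} ∑ ⟪e_n, exp(-itH_L) e_n⟫` (`Anderson.charFun_eigenDist`). By locality this is, up to
small errors, an average of translates of a bounded local observable, so a law of large numbers
(`Anderson.ae_tendsto_boxAvg_translate`: second moments along the squares, then interpolation) gives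
almost sure convergence to the mean return amplitude, first for rational `t` and then, by
equicontinuity, for all `t` simultaneously (`Anderson.ae_forall_tendsto_traceAvg`). By tightness the
limit is the characteristic function of a probability measure, to which the eigenvalue distributions
converge weakly; without atoms this is convergence at every point.

*The Cauchy factor.* In a finite volume, the entries of the `N`-th power of the Trotter product
`exp(-iτΔ) exp(-iτV)` with `τ = t/N` are combinations of the characters `exp(-iτ ∑ k_x ω_x)` with
`k_x ≥ 0` and `∑ k_x = N` (`Anderson.inner_trotterStep_pow_mem`). The characteristic function
`exp(-λ|s|)` of the Cauchy distribution is multiplicative on arguments of one sign, so the Cauchy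
part of the potential contributes exactly `exp(-λ|τ|N) = exp(-λ|t|)` to the mean of each of them,
whatever the `k_x` are. In the limit the mean return amplitude of `μ₁ ∗ μ₂` is `exp(-λ|t|)` times
that of `μ₂` (`Anderson.meanAmp_cauchy_conv`). Thus `ν` is the convolution of the Cauchy
distribution with the measure obtained from `μ₂`, and in particular it has no atoms.
-/

/-! ### One-parameter unitary groups -/

section BoundedGenerator

variable {E : Type*} [NormedAddCommGroup E] [InnerProductSpace ℂ E] [CompleteSpace E]

/-- The norm-continuous group `t ↦ exp(-itA)` generated by a bounded operator `A`. -/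
noncomputable def expGroup (A : E →L[ℂ] E) (t : ℝ) : E →L[ℂ] E :=
  NormedSpace.exp (t • (-(Complex.I • A)))

theorem expGroup_zero (A : E →L[ℂ] E) : expGroup A 0 = 1 := by
  simp [expGroup]

theorem expGroup_add (A : E →L[ℂ] E) (s t : ℝ) :
    expGroup A (s + t) = expGroup A s * expGroup A t := by
  let _ : NormedAlgebra ℚ (E →L[ℂ] E) := NormedAlgebra.restrictScalars ℚ ℂ _
  rw [expGroup, add_smul, NormedSpace.exp_add_of_commute]
  · rfl
  · exact ((Commute.refl _).smul_left s).smul_right t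

theorem hasDerivAt_expGroup (A : E →L[ℂ] E) (t : ℝ) :
    HasDerivAt (expGroup A) (expGroup A t * (-(Complex.I • A))) t :=
  hasDerivAt_exp_smul_const (𝕂 := ℝ) (-(Complex.I • A)) t

theorem hasDerivAt_expGroup' (A : E →L[ℂ] E) (t : ℝ) :
    HasDerivAt (expGroup A) (-(Complex.I • A) * expGroup A t) t :=
  hasDerivAt_exp_smul_const' (𝕂 := ℝ) (-(Complex.I • A)) t

theorem expGroup_mem_unitary {A : E →L[ℂ] E} (hA : IsSelfAdjoint A) (t : ℝ) :
    expGroup A t ∈ unitary (E →L[ℂ] E) := by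
  let _ : NormedAlgebra ℚ (E →L[ℂ] E) := NormedAlgebra.restrictScalars ℚ ℂ _
  refine NormedSpace.exp_mem_unitary_of_mem_skewAdjoint ?_
  rw [skewAdjoint.mem_iff, star_smul, star_neg, star_smul, hA.star_eq]
  simp

theorem norm_expGroup_apply {A : E →L[ℂ] E} (hA : IsSelfAdjoint A) (t : ℝ) (v : E) :
    ‖expGroup A t v‖ = ‖v‖ :=
  ContinuousLinearMap.norm_map_of_mem_unitary (expGroup_mem_unitary hA t) v

theorem commute_expGroup {A B : E →L[ℂ] E} (h : Commute B A) (t : ℝ) :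
    Commute B (expGroup A t) := by
  refine Commute.exp_right ?_
  exact ((h.smul_right Complex.I).neg_right).smul_right t

theorem expGroup_apply_of_eigenvector {A : E →L[ℂ] E} {v : E} {c : ℂ} (h : A v = c • v) (t : ℝ) :
    expGroup A t v = Complex.exp (-(Complex.I * t * c)) • v := by
  let _ : NormedAlgebra ℚ (E →L[ℂ] E) := NormedAlgebra.restrictScalars ℚ ℂ _
  set B : E →L[ℂ] E := t • (-(Complex.I • A)) with hB
  have hBv : B v = (-(Complex.I * t * c)) • v := by
    rw [hB, smul_apply, neg_apply,
      smul_apply, h, ← Complex.coe_smul, smul_neg, smul_smul, smul_smul,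
      ← neg_smul]
    ring_nf
  have hpow : ∀ k : ℕ, (B ^ k) v = (-(Complex.I * t * c)) ^ k • v := by
    intro k
    induction k with
    | zero => simp
    | succ k ih =>
      rw [pow_succ, mul_apply_eq_comp, hBv, map_smul, ih, smul_smul, pow_succ, mul_comm]
  have h1 : HasSum (fun k : ℕ => ((k.factorial : ℂ)⁻¹ • B ^ k) v) (expGroup A t v) :=
    (NormedSpace.exp_series_hasSum_exp' (𝕂 := ℂ) B).mapL (ContinuousLinearMap.apply ℂ E v)
  have h2 : HasSum (fun k : ℕ => ((k.factorial : ℂ)⁻¹ • (-(Complex.I * t * c)) ^ k) • v)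
      (Complex.exp (-(Complex.I * t * c)) • v) := by
    rw [Complex.exp_eq_exp_ℂ]
    exact (NormedSpace.exp_series_hasSum_exp' (𝕂 := ℂ) (-(Complex.I * t * c))).smul_const v
  refine h1.unique (h2.congr_fun ?_)
  intro k
  simp [hpow, smul_smul]

/-- **Duhamel's bound.** If `A₁ X - X A₂` is small along the orbit of `v` under `exp(-isA₂)`, then
`X` almost intertwines the two groups at `v`. -/
theorem norm_expGroup_intertwine_sub_le {A₁ A₂ : E →L[ℂ] E} (h₁ : IsSelfAdjoint A₁)
    (X : E →L[ℂ] E) (v : E) (t C : ℝ)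
    (hC : ∀ s : ℝ, |s| ≤ |t| → ‖(A₁ * X - X * A₂) (expGroup A₂ s v)‖ ≤ C) :
    ‖X (expGroup A₂ t v) - expGroup A₁ t (X v)‖ ≤ |t| * C := by
  set F : ℝ → E := fun s => (expGroup A₁ (t * (1 - s)) * X * expGroup A₂ (t * s)) v with hF
  set F' : ℝ → E := fun s =>
    (t : ℂ) • Complex.I • expGroup A₁ (t * (1 - s)) ((A₁ * X - X * A₂) (expGroup A₂ (t * s) v))
    with hF'
  have hderiv : ∀ s : ℝ, HasDerivAt F (F' s) s := by
    intro s
    have e1 : HasDerivAt (fun s : ℝ => t * (1 - s)) (-t) s := by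
      simpa using ((hasDerivAt_id s).const_sub 1).const_mul t
    have e2 : HasDerivAt (fun s : ℝ => t * s) t s := by
      simpa using (hasDerivAt_id s).const_mul t
    have d1 := (hasDerivAt_expGroup A₁ (t * (1 - s))).scomp s e1
    have d2 := (hasDerivAt_expGroup' A₂ (t * s)).scomp s e2
    have d3 := ((d1.mul_const X).mul d2)
    have d4 := ((ContinuousLinearMap.apply ℂ E v).restrictScalars ℝ).hasFDerivAt.comp_hasDerivAt
      s d3
    refine d4.congr_deriv ?_
    simp only [hF', ContinuousLinearMap.coe_restrictScalars', ContinuousLinearMap.apply_apply,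
      add_apply, mul_apply_eq_comp, smul_apply,
      neg_apply, sub_apply, Function.comp_apply,
      map_neg, map_smul, map_sub, neg_smul, smul_neg, neg_neg, smul_sub, ← Complex.coe_smul]
    abel
  have hbd : ∀ s ∈ Set.Ico (0 : ℝ) 1, ‖F' s‖ ≤ |t| * C := by
    intro s hs
    simp only [hF', norm_smul, Complex.norm_real, Real.norm_eq_abs, Complex.norm_I, one_mul,
      norm_expGroup_apply h₁]
    refine mul_le_mul_of_nonneg_left (hC _ ?_) (abs_nonneg t)
    rw [abs_mul]
    exact mul_le_of_le_one_right (abs_nonneg t) (abs_le.2 ⟨by linarith [hs.1], hs.2.le⟩)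
  have := norm_image_sub_le_of_norm_deriv_le_segment_01'
    (fun s _ => (hderiv s).hasDerivWithinAt) hbd
  simpa [hF, expGroup_zero] using this

theorem norm_expGroup_sub_le {A : E →L[ℂ] E} (hA : IsSelfAdjoint A) (v : E) (s t : ℝ) :
    ‖expGroup A s v - expGroup A t v‖ ≤ |s - t| * ‖A v‖ := by
  have h : ∀ r : ℝ, ‖expGroup A r v - v‖ ≤ |r| * ‖A v‖ := by
    intro r
    have := norm_expGroup_intertwine_sub_le (A₁ := 0) (A₂ := A) (IsSelfAdjoint.zero _) 1 v r ‖A v‖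
      (by
        intro s _
        have hc := commute_expGroup (Commute.refl A) s
        have : A (expGroup A s v) = expGroup A s (A v) := by
          simpa using congrArg (fun T : E →L[ℂ] E => T v) hc.eq
        simp [this, norm_expGroup_apply hA])
    simpa [expGroup] using this
  have e : s = t + (s - t) := by ring
  conv_lhs => rw [e, expGroup_add, mul_apply_eq_comp, ← map_sub,
    norm_expGroup_apply hA]
  exact h _

theorem norm_expGroup_sub_le_two {A : E →L[ℂ] E} (hA : IsSelfAdjoint A) (v : E) (s t : ℝ) :
    ‖expGroup A s v - expGroup A t v‖ ≤ 2 * ‖v‖ := by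
  refine (norm_sub_le _ _).trans ?_
  rw [norm_expGroup_apply hA, norm_expGroup_apply hA, two_mul]

theorem expGroup_conj {A T T' : E →L[ℂ] E} (h : T * T' = 1) (h' : T' * T = 1) (t : ℝ) :
    expGroup (T * A * T') t = T * expGroup A t * T' := by
  let _ : NormedAlgebra ℚ (E →L[ℂ] E) := NormedAlgebra.restrictScalars ℚ ℂ _
  have := NormedSpace.exp_units_conj (⟨T, T', h, h'⟩ : (E →L[ℂ] E)ˣ) (t • (-(Complex.I • A)))
  simp only [Units.val_mk, Units.inv_mk] at this
  rw [expGroup, expGroup, ← this]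
  congr 1
  simp [mul_assoc]

theorem continuous_expGroup_generator {α : Type*} [TopologicalSpace α] {A : α → E →L[ℂ] E}
    (hA : Continuous A) (t : ℝ) : Continuous fun a => expGroup (A a) t := by
  let _ : NormedAlgebra ℚ (E →L[ℂ] E) := NormedAlgebra.restrictScalars ℚ ℂ _
  exact NormedSpace.exp_continuous.comp ((hA.const_smul Complex.I).neg.const_smul t)

end BoundedGenerator

section Uniqueness

variable {E : Type*} [NormedAddCommGroup E] [InnerProductSpace ℂ E] [CompleteSpace E]
  {A : E →ₗ.[ℂ] E} {U V : ℝ → E →L[ℂ] E}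

theorem IsUnitaryGroupOf.hasDerivAt (hU : IsUnitaryGroupOf A U) {x y : E} (h : (x, y) ∈ A.graph)
    (t : ℝ) : HasDerivAt (fun s => U s x) (U t (-(Complex.I • y))) t := by
  have h0 := (hU.generator x y).1 h
  have h1 : HasDerivAt (fun s : ℝ => U (s - t) x) (-(Complex.I • y)) t := by
    have := HasDerivAt.comp_sub_const (x := t) t (f := fun s => U s x) (f' := -(Complex.I • y))
      (by simpa using h0)
    simpa using this
  have h2 := ((U t).restrictScalars ℝ).hasFDerivAt.comp_hasDerivAt t h1
  refine h2.congr_of_eventuallyEq (Eventually.of_forall fun s => ?_)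
  have : U s = U t * U (s - t) := by rw [← hU.map_add]; congr 1; ring
  simp [this]

theorem IsUnitaryGroupOf.map_mem_graph (hU : IsUnitaryGroupOf A U) {x y : E}
    (h : (x, y) ∈ A.graph) (t : ℝ) : (U t x, U t y) ∈ A.graph := by
  rw [hU.generator]
  have h2 := ((U t).restrictScalars ℝ).hasFDerivAt.comp_hasDerivAt (0 : ℝ)
    ((hU.generator x y).1 h)
  have e : (U t).restrictScalars ℝ (-(Complex.I • y)) = -(Complex.I • U t y) := by simp
  rw [e] at h2
  refine h2.congr_of_eventuallyEq (Eventually.of_forall fun s => ?_)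
  have : U s * U t = U t * U s := by rw [← hU.map_add, ← hU.map_add, add_comm]
  simpa using congrArg (fun T : E →L[ℂ] E => T x) this

/-- The generator of a unitary group is symmetric. -/
theorem IsUnitaryGroupOf.inner_graph (hU : IsUnitaryGroupOf A U) {x y x' y' : E}
    (h : (x, y) ∈ A.graph) (h' : (x', y') ∈ A.graph) : inner ℂ y x' = inner ℂ x y' := by
  have d := ((hU.generator x y).1 h).inner ℂ ((hU.generator x' y').1 h')
  have e : (fun t => inner ℂ (U t x) (U t x')) = fun _ => inner ℂ x x' := by
    funext t
    exact ContinuousLinearMap.inner_map_map_of_mem_unitary (hU.mem_unitary t) x x'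
  rw [e] at d
  have := d.unique (hasDerivAt_const _ _)
  rw [hU.map_zero] at this
  simp only [one_apply_eq_self, inner_neg_right, inner_neg_left, inner_smul_left,
    inner_smul_right, Complex.conj_I] at this
  have h3 : Complex.I * (inner ℂ y x' - inner ℂ x y') = 0 := by linear_combination this
  simpa [sub_eq_zero] using h3

/-- A densely defined operator generates at most one unitary group: for `x, y` in the domain,
`⟪V t y, U t x⟫` has derivative zero, as the generator is symmetric. -/
theorem IsUnitaryGroupOf.unique (hU : IsUnitaryGroupOf A U) (hV : IsUnitaryGroupOf A V)
    (hA : Dense (A.domain : Set E)) : U = V := by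
  have key : ∀ (t : ℝ) (x x' : E), x ∈ A.domain → x' ∈ A.domain →
      inner ℂ (V t x') (U t x) = inner ℂ x' x := by
    intro t x x' hx hx'
    have hg : (x, A ⟨x, hx⟩) ∈ A.graph := A.mem_graph ⟨x, hx⟩
    have hg' : (x', A ⟨x', hx'⟩) ∈ A.graph := A.mem_graph ⟨x', hx'⟩
    have d : ∀ s, HasDerivAt (fun s => inner ℂ (V s x') (U s x)) 0 s := by
      intro s
      refine ((hV.hasDerivAt hg' s).inner ℂ (hU.hasDerivAt hg s)).congr_deriv ?_
      have := hU.inner_graph (hV.map_mem_graph hg' s) (hU.map_mem_graph hg s)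
      simp only [map_neg, map_smul, inner_neg_right, inner_neg_left, inner_smul_left,
        inner_smul_right, Complex.conj_I, this]
      ring
    have := is_const_of_deriv_eq_zero (fun s => (d s).differentiableAt) (fun s => (d s).deriv) t 0
    simpa [hU.map_zero, hV.map_zero] using this
  funext t
  refine ContinuousLinearMap.coeFn_injective (Continuous.ext_on hA (U t).continuous
    (V t).continuous fun x hx => ?_)
  have h1 : ∀ x' ∈ (A.domain : Set E), inner ℂ x' ((star (V t) * U t) x) = inner ℂ x' x := by
    intro x' hx'
    rw [mul_apply_eq_comp, ContinuousLinearMap.star_eq_adjoint,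
      ContinuousLinearMap.adjoint_inner_right]
    exact key t x x' hx hx'
  have h2 : (star (V t) * U t) x = x := by
    refine ext_inner_left ℂ fun w => ?_
    exact congrFun (Continuous.ext_on hA (by fun_prop) (by fun_prop) h1) w
  calc U t x = (V t * star (V t)) (U t x) := by
        rw [Unitary.mul_star_self_of_mem (hV.mem_unitary t)]; simp
    _ = V t ((star (V t) * U t) x) := by simp
    _ = V t x := by rw [h2]

theorem IsUnitaryGroupOf.expNegI_eq (hU : IsUnitaryGroupOf A U)
    (hA : Dense (A.domain : Set E)) : expNegI A = U := by
  have h : ∃ U : ℝ → E →L[ℂ] E, IsUnitaryGroupOf A U := ⟨U, hU⟩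
  rw [expNegI, dif_pos h]
  exact h.choose_spec.unique hU hA

end Uniqueness

/-! ### Finite-volume operators on `ℓ²(ℤ^d)` and finite speed of propagation -/

namespace Anderson

variable {d : ℕ}

theorem basisVec_apply (n m : Lattice d) : (basisVec n : Hilb d) m = if m = n then 1 else 0 := by
  simp [basisVec, Pi.single_apply]

theorem norm_basisVec (n : Lattice d) : ‖(basisVec n : Hilb d)‖ = 1 := by
  rw [basisVec, lp.norm_single (by norm_num)]
  simp

theorem inner_basisVec_left (n : Lattice d) (u : Hilb d) : inner ℂ (basisVec n) u = u n := by
  rw [basisVec, lp.inner_single_left]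
  simp

theorem memℓp_comp_add {u : Lattice d → ℂ} (hu : Memℓp u 2) (a : Lattice d) :
    Memℓp (fun n => u (n + a)) 2 := by
  have h2 : 0 < (2 : ℝ≥0∞).toReal := by norm_num
  refine memℓp_gen ?_
  exact (hu.summable h2).comp_injective (Equiv.addRight a).injective

/-- The translation `(T_a u)(n) = u (n + a)` of `ℓ²(ℤ^d)`, as a linear isometry. -/
noncomputable def shiftIsometry (a : Lattice d) : Hilb d →ₗᵢ[ℂ] Hilb d where
  toFun := fun u => ⟨fun n => u (n + a), memℓp_comp_add u.2 a⟩
  map_add' := fun _ _ => rfl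
  map_smul' := fun _ _ => rfl
  norm_map' := fun u => by
    have h2 : 0 < (2 : ℝ≥0∞).toReal := by norm_num
    rw [lp.norm_eq_tsum_rpow h2, lp.norm_eq_tsum_rpow h2]
    congr 1
    exact (Equiv.addRight a).tsum_eq fun n => ‖u n‖ ^ (2 : ℝ≥0∞).toReal

/-- The translation `(T_a u)(n) = u (n + a)` of `ℓ²(ℤ^d)`, as a bounded operator. -/
noncomputable def shift (a : Lattice d) : Hilb d →L[ℂ] Hilb d :=
  (shiftIsometry a).toContinuousLinearMap

theorem shift_apply (a : Lattice d) (u : Hilb d) (n : Lattice d) : shift a u n = u (n + a) := rfl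

theorem norm_shift_apply (a : Lattice d) (u : Hilb d) : ‖shift a u‖ = ‖u‖ :=
  (shiftIsometry a).norm_map u

theorem shift_mul_shift_neg (a : Lattice d) : shift a * shift (-a) = 1 := by
  ext u n
  simp [shift_apply]

theorem shift_neg_mul_shift (a : Lattice d) : shift (-a) * shift a = 1 := by
  ext u n
  simp [shift_apply]

theorem shift_neg_basisVec (a n : Lattice d) :
    shift (-a) (basisVec n : Hilb d) = basisVec (n + a) := by
  ext m
  simp [shift_apply, basisVec_apply, add_neg_eq_iff_eq_add]

theorem star_shift (a : Lattice d) : star (shift a) = shift (-a) := by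
  rw [ContinuousLinearMap.star_eq_adjoint]
  refine ((ContinuousLinearMap.eq_adjoint_iff _ _).2 fun u v => ?_).symm
  rw [lp.inner_eq_tsum, lp.inner_eq_tsum,
    ← (Equiv.addRight a).tsum_eq fun n => inner ℂ (shift (-a) u n) (v n)]
  simp [shift_apply]

/-- Pointwise domination, up to a translation, in `ℓ²(ℤ^d)`. -/
theorem norm_le_of_pointwise {u v : Hilb d} {C : ℝ} (hC : 0 ≤ C) (a : Lattice d)
    (h : ∀ n, ‖v n‖ ≤ C * ‖u (n + a)‖) : ‖v‖ ≤ C * ‖u‖ := by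
  have : ‖v‖ ≤ ‖(C : ℂ) • shift a u‖ := by
    refine lp.norm_mono (by norm_num) fun n => ?_
    rw [lp.coeFn_smul, Pi.smul_apply, norm_smul, shift_apply]
    simpa [abs_of_nonneg hC] using h n
  refine this.trans ?_
  rw [norm_smul, norm_shift_apply]
  simp [abs_of_nonneg hC]

/-- Multiplication by the function that is `f` on the finite set `S` and zero elsewhere. -/
noncomputable def diagOn (S : Finset (Lattice d)) (f : Lattice d → ℂ) : Hilb d →L[ℂ] Hilb d :=
  ∑ x ∈ S, f x • (lp.evalCLM ℂ (fun _ : Lattice d => ℂ) 2 x).smulRight (basisVec x)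

theorem diagOn_apply (S : Finset (Lattice d)) (f : Lattice d → ℂ) (u : Hilb d) (n : Lattice d) :
    diagOn S f u n = if n ∈ S then f n * u n else 0 := by
  simp only [diagOn, sum_apply, lp.coeFn_sum, Finset.sum_apply]
  simp [basisVec_apply, lp.evalCLM]

theorem star_diagOn (S : Finset (Lattice d)) (f : Lattice d → ℝ) :
    star (diagOn S fun n => (f n : ℂ)) = diagOn S fun n => (f n : ℂ) := by
  rw [ContinuousLinearMap.star_eq_adjoint]
  refine ((ContinuousLinearMap.eq_adjoint_iff _ _).2 fun u v => ?_).symm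
  rw [lp.inner_eq_tsum, lp.inner_eq_tsum]
  congr 1
  funext n
  rw [diagOn_apply, diagOn_apply]
  split_ifs
  · simp
    ring
  · simp

/-- Hopping by `a` inside `S`. -/
noncomputable def hopOn (S : Finset (Lattice d)) (a : Lattice d) : Hilb d →L[ℂ] Hilb d :=
  diagOn S 1 * shift a * diagOn S 1

theorem hopOn_apply (S : Finset (Lattice d)) (a : Lattice d) (u : Hilb d) (n : Lattice d) :
    hopOn S a u n = if n ∈ S ∧ n + a ∈ S then u (n + a) else 0 := by
  simp only [hopOn, mul_apply_eq_comp, diagOn_apply, shift_apply, Pi.one_apply, one_mul]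
  split_ifs <;> tauto

/-- The `2d` unit steps `± e_i` of the lattice. -/
def step (p : Fin d × Bool) : Lattice d := if p.2 then Pi.single p.1 1 else -Pi.single p.1 1

theorem norm_step (p : Fin d × Bool) : ‖(step p : Lattice d)‖ ≤ 1 := by
  have h : ‖(Pi.single p.1 1 : Lattice d)‖ ≤ 1 := by
    rw [pi_norm_le_iff_of_nonneg zero_le_one]
    intro i
    rw [Pi.single_apply]
    split_ifs <;> simp
  rw [step]
  split_ifs
  · exact h
  · rwa [norm_neg]

theorem sum_step {M : Type*} [AddCommMonoid M] (f : Lattice d → M) :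
    ∑ p, f (step p) = ∑ i : Fin d, (f (Pi.single i 1) + f (-Pi.single i 1)) := by
  rw [Fintype.sum_prod_type]
  simp [step]

/-- The restriction `χ_S (Δ + V^ω) χ_S` to a finite set `S`, extended by zero to `ℓ²(ℤ^d)`. -/
noncomputable def boxOp (S : Finset (Lattice d)) (ω : Lattice d → ℝ) : Hilb d →L[ℂ] Hilb d :=
  ∑ p, hopOn S (step p) + diagOn S fun n => (ω n : ℂ)

theorem boxOp_apply (S : Finset (Lattice d)) (ω : Lattice d → ℝ) (u : Hilb d) (n : Lattice d) :
    boxOp S ω u n = ∑ p, hopOn S (step p) u n + diagOn S (fun n => (ω n : ℂ)) u n := by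
  rw [boxOp, add_apply, sum_apply, lp.coeFn_add, Pi.add_apply, lp.coeFn_sum, Finset.sum_apply]

/-- In finite volume `boxOp` acts on functions supported in `S` as the formal operator, followed by
restriction to `S`. -/
theorem boxOp_apply_eq_formalOp (S : Finset (Lattice d)) (ω : Lattice d → ℝ) (u : Hilb d)
    (hu : ∀ n ∉ S, u n = 0) (n : Lattice d) :
    boxOp S ω u n = if n ∈ S then formalOp ω u n else 0 := by
  rw [boxOp_apply, diagOn_apply]
  simp only [hopOn_apply]
  by_cases hn : n ∈ S
  · have : ∀ p : Fin d × Bool, (if n ∈ S ∧ n + step p ∈ S then u (n + step p) else 0)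
        = u (n + step p) := by
      intro p
      by_cases h : n + step p ∈ S
      · simp [hn, h]
      · simp [h, hu _ h]
    simp only [this, if_pos hn]
    rw [sum_step fun a => u (n + a)]
    simp [formalOp, sub_eq_add_neg]
  · simp [hn]

theorem boxOp_isSelfAdjoint (S : Finset (Lattice d)) (ω : Lattice d → ℝ) :
    IsSelfAdjoint (boxOp S ω) := by
  have h1 : star (diagOn S (1 : Lattice d → ℂ)) = diagOn S 1 := by
    have := star_diagOn S (fun _ => (1 : ℝ))
    simp only [Complex.ofReal_one] at this
    exact this
  have h2 : ∀ a, star (hopOn S a) = hopOn S (-a) := by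
    intro a
    simp only [hopOn, star_mul, h1, star_shift, mul_assoc]
  rw [IsSelfAdjoint, boxOp, star_add, star_diagOn, star_sum]
  congr 1
  simp only [h2]
  rw [sum_step (fun a => hopOn S (-a)), sum_step (fun a => hopOn S a)]
  refine Finset.sum_congr rfl fun i _ => ?_
  rw [neg_neg, add_comm]

theorem commute_boxOp_diagOn_one (S : Finset (Lattice d)) (ω : Lattice d → ℝ) :
    Commute (diagOn S 1) (boxOp S ω) := by
  ext u n
  rw [mul_apply_eq_comp, mul_apply_eq_comp, diagOn_apply, boxOp_apply, boxOp_apply]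
  simp only [diagOn_apply, hopOn_apply, Pi.one_apply, one_mul]
  by_cases hn : n ∈ S
  · simp only [hn, if_true, true_and]
    congr 1
    refine Finset.sum_congr rfl fun p _ => ?_
    split_ifs <;> rfl
  · simp [hn]

/-- The finite-volume evolution preserves `ℓ²(S)`. -/
theorem expGroup_boxOp_support (S : Finset (Lattice d)) (ω : Lattice d → ℝ) (t : ℝ) {u : Hilb d}
    (hu : ∀ n ∉ S, u n = 0) (n : Lattice d) (hn : n ∉ S) :
    expGroup (boxOp S ω) t u n = 0 := by
  have h1 : diagOn S 1 u = u := by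
    ext m
    rw [diagOn_apply]
    split_ifs with h
    · simp
    · exact (hu m h).symm
  have h2 := congrArg (fun T : Hilb d →L[ℂ] Hilb d => T u n)
    (commute_expGroup (commute_boxOp_diagOn_one S ω) t).eq
  simp only [mul_apply_eq_comp, h1, diagOn_apply, if_neg hn] at h2
  exact h2.symm

theorem norm_boxOp_basisVec_le (S : Finset (Lattice d)) (ω : Lattice d → ℝ) (n : Lattice d) :
    ‖boxOp S ω (basisVec n)‖ ≤ 2 * d + |ω n| := by
  have h1 : ∀ p, ‖hopOn S (step p) (basisVec n : Hilb d)‖ ≤ 1 := by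
    intro p
    have := norm_le_of_pointwise (u := (basisVec n : Hilb d))
      (v := hopOn S (step p) (basisVec n : Hilb d)) zero_le_one (step p) (by
        intro m
        rw [hopOn_apply]
        split_ifs <;> simp)
    simpa [norm_basisVec] using this
  have h2 : ‖diagOn S (fun m => (ω m : ℂ)) (basisVec n : Hilb d)‖ ≤ |ω n| := by
    have := norm_le_of_pointwise (u := (basisVec n : Hilb d))
      (v := diagOn S (fun m => (ω m : ℂ)) (basisVec n : Hilb d)) (abs_nonneg (ω n)) 0 (by
        intro m
        rw [diagOn_apply, basisVec_apply, add_zero, basisVec_apply]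
        split_ifs with h1 h2
        · simp [h2]
        all_goals simp)
    simpa [norm_basisVec] using this
  rw [boxOp, add_apply, sum_apply]
  refine (norm_add_le _ _).trans (add_le_add ?_ h2)
  refine (norm_sum_le _ _).trans ((Finset.sum_le_sum fun p _ => h1 p).trans ?_)
  simp [mul_comm]

/-- The cube of side `2R + 1` centred at `c`. -/
noncomputable def cube (c : Lattice d) (R : ℕ) : Finset (Lattice d) :=
  Fintype.piFinset fun i => Finset.Icc (c i - R) (c i + R)

theorem mem_cube {c : Lattice d} {R : ℕ} {n : Lattice d} :
    n ∈ cube c R ↔ ∀ i, |n i - c i| ≤ R := by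
  simp only [cube, Fintype.mem_piFinset, Finset.mem_Icc, abs_le]
  refine forall_congr' fun i => ?_
  constructor <;> rintro ⟨h1, h2⟩ <;> constructor <;> linarith

theorem box_eq_cube (R : ℕ) : box d R = cube 0 R := by
  simp [box, cube]

theorem mem_cube_iff_norm {c : Lattice d} {R : ℕ} {n : Lattice d} :
    n ∈ cube c R ↔ ‖n - c‖ ≤ R := by
  rw [mem_cube, pi_norm_le_iff_of_nonneg (Nat.cast_nonneg R)]
  refine forall_congr' fun i => ?_
  rw [Pi.sub_apply, Int.norm_eq_abs]
  exact_mod_cast Iff.rfl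

theorem le_norm_of_notMem_cube {c : Lattice d} {R : ℕ} {n : Lattice d} (h : n ∉ cube c R) :
    (R : ℝ) + 1 ≤ ‖n - c‖ := by
  rw [mem_cube] at h
  push Not at h
  obtain ⟨i, hi⟩ := h
  refine le_trans ?_ (norm_le_pi_norm (n - c) i)
  rw [Pi.sub_apply, Int.norm_eq_abs]
  exact_mod_cast hi

theorem self_mem_cube (c : Lattice d) (R : ℕ) : c ∈ cube c R := by
  simp [mem_cube]

theorem cube_subset_cube {c c' : Lattice d} {R R' : ℕ} (h : ‖c - c'‖ + R ≤ R') :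
    cube c R ⊆ cube c' R' := by
  intro n hn
  rw [mem_cube_iff_norm] at hn ⊢
  calc ‖n - c'‖ = ‖(n - c) + (c - c')‖ := by congr 1; abel
    _ ≤ ‖n - c‖ + ‖c - c'‖ := norm_add_le _ _
    _ ≤ R' := by linarith

theorem card_cube (c : Lattice d) (R : ℕ) : (cube c R).card = (2 * R + 1) ^ d := by
  rw [cube, Fintype.card_piFinset]
  have : ∀ i : Fin d, (Finset.Icc (c i - (R : ℤ)) (c i + R)).card = 2 * R + 1 := by
    intro i
    rw [Int.card_Icc]
    omega
  simp [this]

/-- Multiplication by the distance to the centre of a cube. Its commutator with the finite-volume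
operator is bounded uniformly in the potential and in the size of the cube. -/
theorem norm_commutator_dist_le (c : Lattice d) (R : ℕ) (ω : Lattice d → ℝ) (v : Hilb d) :
    ‖(boxOp (cube c R) ω * diagOn (cube c R) (fun n => (‖n - c‖ : ℂ)) -
      diagOn (cube c R) (fun n => (‖n - c‖ : ℂ)) * boxOp (cube c R) ω) v‖ ≤ 2 * d * ‖v‖ := by
  set B := cube c R
  set X := diagOn B (fun n => (‖n - c‖ : ℂ)) with hX
  have hdiag : diagOn B (fun n => (ω n : ℂ)) * X = X * diagOn B (fun n => (ω n : ℂ)) := by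
    ext u n
    simp only [hX, mul_apply_eq_comp, diagOn_apply]
    split_ifs <;> ring
  have hop : ∀ p, ‖(hopOn B (step p) * X - X * hopOn B (step p)) v‖ ≤ 1 * ‖v‖ := by
    intro p
    refine norm_le_of_pointwise zero_le_one (step p) fun n => ?_
    rw [sub_apply, lp.coeFn_sub, Pi.sub_apply]
    simp only [hX, mul_apply_eq_comp, diagOn_apply, hopOn_apply]
    by_cases h : n ∈ B ∧ n + step p ∈ B
    · simp only [h.1, h.2, and_self, if_true]
      rw [← sub_mul, norm_mul]
      refine mul_le_mul_of_nonneg_right ?_ (norm_nonneg _)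
      rw [← Complex.ofReal_sub, Complex.norm_real]
      refine (abs_norm_sub_norm_le _ _).trans ?_
      rw [show n + step p - c - (n - c) = step p by abel]
      exact norm_step p
    · rw [if_neg h, if_neg h]
      simp
  have e : boxOp B ω * X - X * boxOp B ω =
      ∑ p, (hopOn B (step p) * X - X * hopOn B (step p)) := by
    rw [boxOp, add_mul, mul_add, hdiag, Finset.sum_mul, Finset.mul_sum, add_sub_add_right_eq_sub,
      Finset.sum_sub_distrib]
  rw [e, sum_apply]
  refine (norm_sum_le _ _).trans ((Finset.sum_le_sum fun p _ => hop p).trans ?_)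
  simp [mul_comm]

/-- **Finite speed of propagation**, uniformly in the potential: up to time `t`, the evolution of
`e_c` does not feel the complement of a large cube centred at `c`. -/
theorem norm_expGroup_boxOp_sub_le {S : Finset (Lattice d)} {c : Lattice d} {R : ℕ} (hR : 0 < R)
    (hS : cube c R ⊆ S) (ω : Lattice d → ℝ) (t : ℝ) :
    ‖expGroup (boxOp S ω) t (basisVec c) - expGroup (boxOp (cube c R) ω) t (basisVec c)‖
      ≤ (2 * d * t) ^ 2 / R := by
  have hR' : (0 : ℝ) < R := by exact_mod_cast hR
  set B := cube c R with hB
  set X := diagOn B (fun n => (‖n - c‖ : ℂ)) with hX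
  have hXc : X (basisVec c) = 0 := by
    ext n
    rw [hX, diagOn_apply, basisVec_apply]
    by_cases h : n = c <;> simp [h]
  have hsupp : ∀ n ∉ B, (basisVec c : Hilb d) n = 0 := by
    intro n hn
    rw [basisVec_apply, if_neg]
    rintro rfl
    exact hn (self_mem_cube _ _)
  -- the distance from the centre grows at most linearly in time
  have hball : ∀ s : ℝ, ‖X (expGroup (boxOp B ω) s (basisVec c))‖ ≤ |s| * (2 * d) := by
    intro s
    have := norm_expGroup_intertwine_sub_le (A₂ := boxOp B ω) (boxOp_isSelfAdjoint B ω) X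
      (basisVec c) s (2 * d) (by
        intro r _
        refine (norm_commutator_dist_le c R ω _).trans ?_
        rw [norm_expGroup_apply (boxOp_isSelfAdjoint B ω), norm_basisVec, mul_one])
    simpa [hXc] using this
  -- the operators of `S` and of the cube differ by the hopping across the boundary of the cube
  have hbdry : ∀ w : Hilb d, (∀ n ∉ B, w n = 0) →
      ‖(boxOp S ω - boxOp B ω) w‖ ≤ 2 * d * ((R : ℝ)⁻¹ * ‖X w‖) := by
    intro w hw
    have h0 : diagOn S (fun n => (ω n : ℂ)) w = diagOn B (fun n => (ω n : ℂ)) w := by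
      ext n
      rw [diagOn_apply, diagOn_apply]
      by_cases h : n ∈ B
      · simp [h, hS h]
      · simp [h, hw n h]
    have h1 : ∀ p, ‖(hopOn S (step p) - hopOn B (step p)) w‖ ≤ (R : ℝ)⁻¹ * ‖X w‖ := by
      intro p
      refine norm_le_of_pointwise (inv_nonneg.2 hR'.le) (step p) fun n => ?_
      rw [sub_apply, lp.coeFn_sub, Pi.sub_apply, hopOn_apply, hopOn_apply, hX, diagOn_apply]
      by_cases hna : n + step p ∈ B
      · by_cases hn : n ∈ B
        · simp only [hS hn, hS hna, hn, hna, and_self, if_true, sub_self, norm_zero]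
          positivity
        · have hfar : (R : ℝ) ≤ ‖n + step p - c‖ := by
            have h3 := le_norm_of_notMem_cube hn
            have h4 : ‖n - c‖ ≤ ‖n + step p - c‖ + ‖step p‖ := by
              rw [show n - c = (n + step p - c) - step p by abel]
              exact norm_sub_le _ _
            linarith [norm_step p]
          have hge : ‖w (n + step p)‖ ≤ (R : ℝ)⁻¹ * (‖n + step p - c‖ * ‖w (n + step p)‖) := by
            rw [← mul_assoc]
            refine le_mul_of_one_le_left (norm_nonneg _) ?_
            rw [inv_mul_eq_div, one_le_div hR']
            exact hfar
          simp only [hn, hna, false_and, if_false, if_true, sub_zero, norm_mul,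
            Complex.norm_real, norm_norm]
          split_ifs
          · exact hge
          · rw [norm_zero]; positivity
      · simp [hna, hw _ hna]
    have e : (boxOp S ω - boxOp B ω) w = ∑ p, (hopOn S (step p) - hopOn B (step p)) w := by
      simp only [boxOp, sub_apply, add_apply, sum_apply, h0,
        Finset.sum_sub_distrib]
      abel
    rw [e]
    refine (norm_sum_le _ _).trans ((Finset.sum_le_sum fun p _ => h1 p).trans ?_)
    simp [mul_comm]
  have := norm_expGroup_intertwine_sub_le (A₂ := boxOp B ω) (boxOp_isSelfAdjoint S ω) 1
    (basisVec c) t (2 * d * ((R : ℝ)⁻¹ * (|t| * (2 * d)))) (by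
      intro s hs
      rw [mul_one, one_mul]
      refine (hbdry _ fun n hn => expGroup_boxOp_support B ω s hsupp n hn).trans ?_
      have h5 := hball s
      have h6 : |s| * (2 * d : ℝ) ≤ |t| * (2 * d) :=
        mul_le_mul_of_nonneg_right hs (by positivity)
      gcongr
      exact h5.trans h6)
  rw [norm_sub_rev]
  refine (by simpa using this : _ ≤ _).trans (le_of_eq ?_)
  have : |t| * |t| = t ^ 2 := by rw [abs_mul_abs_self, sq]
  field_simp
  linear_combination ((d : ℝ) ^ 2) * this

/-- The amplitude `⟪e_n, exp(-itH_S) e_n⟫` of returning to `n` at time `t` in the volume `S`. -/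
noncomputable def returnAmp (S : Finset (Lattice d)) (ω : Lattice d → ℝ) (t : ℝ) (n : Lattice d) :
    ℂ :=
  inner ℂ (basisVec n) (expGroup (boxOp S ω) t (basisVec n))

theorem norm_returnAmp_le_one (S : Finset (Lattice d)) (ω : Lattice d → ℝ) (t : ℝ)
    (n : Lattice d) : ‖returnAmp S ω t n‖ ≤ 1 := by
  refine (norm_inner_le_norm _ _).trans ?_
  rw [norm_expGroup_apply (boxOp_isSelfAdjoint S ω), norm_basisVec, one_mul]

theorem norm_returnAmp_sub_le {S : Finset (Lattice d)} {c : Lattice d} {R : ℕ} (hR : 0 < R)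
    (hS : cube c R ⊆ S) (ω : Lattice d → ℝ) (t : ℝ) :
    ‖returnAmp S ω t c - returnAmp (cube c R) ω t c‖ ≤ (2 * d * t) ^ 2 / R := by
  rw [returnAmp, returnAmp, ← inner_sub_right]
  refine (norm_inner_le_norm _ _).trans ?_
  rw [norm_basisVec, one_mul]
  exact norm_expGroup_boxOp_sub_le hR hS ω t

theorem norm_returnAmp_time_sub_le (S : Finset (Lattice d)) (ω : Lattice d → ℝ) (s t : ℝ)
    (n : Lattice d) :
    ‖returnAmp S ω s n - returnAmp S ω t n‖ ≤ min 2 (|s - t| * (2 * d + |ω n|)) := by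
  rw [returnAmp, returnAmp, ← inner_sub_right]
  refine (norm_inner_le_norm _ _).trans ?_
  rw [norm_basisVec, one_mul]
  refine le_min ?_ ?_
  · simpa [norm_basisVec] using
      norm_expGroup_sub_le_two (boxOp_isSelfAdjoint S ω) (basisVec n) s t
  · exact (norm_expGroup_sub_le (boxOp_isSelfAdjoint S ω) (basisVec n) s t).trans
      (mul_le_mul_of_nonneg_left (norm_boxOp_basisVec_le S ω n) (abs_nonneg _))

theorem continuous_boxOp (S : Finset (Lattice d)) : Continuous (boxOp S) := by
  unfold boxOp diagOn
  refine continuous_const.add (continuous_finsetSum _ fun x _ => ?_)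
  exact (Complex.continuous_ofReal.comp (continuous_apply x)).smul continuous_const

theorem continuous_returnAmp (S : Finset (Lattice d)) (t : ℝ) (n : Lattice d) :
    Continuous fun ω => returnAmp S ω t n :=
  continuous_const.inner
    ((continuous_expGroup_generator (continuous_boxOp S) t).clm_apply continuous_const)

theorem measurable_returnAmp (S : Finset (Lattice d)) (t : ℝ) (n : Lattice d) :
    Measurable fun ω => returnAmp S ω t n :=
  (continuous_returnAmp S t n).measurable

theorem returnAmp_congr {S : Finset (Lattice d)} {ω ω' : Lattice d → ℝ}
    (h : ∀ n ∈ S, ω n = ω' n) (t : ℝ) (n : Lattice d) : returnAmp S ω t n = returnAmp S ω' t n := by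
  have : boxOp S ω = boxOp S ω' := by
    unfold boxOp diagOn
    congr 1
    exact Finset.sum_congr rfl fun x hx => by simp only [h x hx]
  rw [returnAmp, returnAmp, this]

/-- Translating the cube to the origin amounts to translating the potential. -/
theorem returnAmp_cube (c : Lattice d) (R : ℕ) (ω : Lattice d → ℝ) (t : ℝ) :
    returnAmp (cube c R) ω t c = returnAmp (cube 0 R) (fun n => ω (n + c)) t 0 := by
  have hmem : ∀ n : Lattice d, n + c ∈ cube c R ↔ n ∈ cube 0 R := by
    intro n; simp [mem_cube]
  have h : boxOp (cube 0 R) (fun n => ω (n + c)) = shift c * boxOp (cube c R) ω * shift (-c) := by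
    ext u n
    simp only [mul_apply_eq_comp, shift_apply, boxOp_apply, hopOn_apply, diagOn_apply, hmem]
    have : ∀ p : Fin d × Bool, n + c + step p = n + step p + c := fun p => by abel
    simp [this, hmem]
  rw [returnAmp, returnAmp, h, expGroup_conj (shift_mul_shift_neg c) (shift_neg_mul_shift c),
    inner_basisVec_left, inner_basisVec_left, mul_apply_eq_comp, mul_apply_eq_comp, shift_apply,
    shift_neg_basisVec]
  simp

end Anderson

/-! ### The unitary group in infinite volume -/

namespace Anderson

variable {d : ℕ}

theorem diagOn_one_eq_sum (S : Finset (Lattice d)) (u : Hilb d) :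
    diagOn S 1 u = ∑ n ∈ S, u n • basisVec n := by
  simp [diagOn, sum_apply, lp.evalCLM]

theorem tendsto_box_atTop : Tendsto (fun L : ℕ => box d L) atTop atTop := by
  refine tendsto_atTop_finset_of_monotone (fun L L' h => ?_) fun n => ⟨⌈‖n‖⌉₊, ?_⟩
  · rw [box_eq_cube, box_eq_cube]
    exact cube_subset_cube (by simpa using h)
  · rw [box_eq_cube, mem_cube_iff_norm, sub_zero]
    exact Nat.le_ceil _

theorem tendsto_diagOn_box (u : Hilb d) :
    Tendsto (fun L : ℕ => diagOn (box d L) 1 u) atTop (𝓝 u) := by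
  have h := (lp.hasSum_single (by norm_num) u : HasSum (fun n => lp.single 2 n (u n)) u)
  refine (Tendsto.comp h tendsto_box_atTop).congr fun L => ?_
  rw [diagOn_one_eq_sum]
  refine Finset.sum_congr rfl fun n _ => ?_
  ext m
  simp [basisVec_apply, Pi.single_apply]

/-- The standard basis spans a dense subspace. -/
theorem mem_of_basisVec_mem {K : Submodule ℂ (Hilb d)} (hK : IsClosed (K : Set (Hilb d)))
    (h : ∀ n, basisVec n ∈ K) (u : Hilb d) : u ∈ K := by
  refine hK.mem_of_tendsto (tendsto_diagOn_box u) (Eventually.of_forall fun L => ?_)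
  rw [diagOn_one_eq_sum]
  exact K.sum_mem fun n _ => K.smul_mem _ (h n)

/-- The evolution in the box `Λ_L`. -/
noncomputable def boxGroup (ω : Lattice d → ℝ) (L : ℕ) (t : ℝ) : Hilb d →L[ℂ] Hilb d :=
  expGroup (boxOp (box d L) ω) t

theorem norm_boxGroup_apply (ω : Lattice d → ℝ) (L : ℕ) (t : ℝ) (u : Hilb d) :
    ‖boxGroup ω L t u‖ = ‖u‖ :=
  norm_expGroup_apply (boxOp_isSelfAdjoint _ ω) t u

theorem cauchySeq_boxGroup_basisVec (ω : Lattice d → ℝ) (t : ℝ) (n : Lattice d) :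
    CauchySeq fun L => boxGroup ω L t (basisVec n) := by
  set C : ℝ := (2 * d * t) ^ 2 with hC
  have hsub : ∀ r L : ℕ, ⌈‖n‖⌉₊ + r ≤ L → cube n r ⊆ box d L := by
    intro r L h
    rw [box_eq_cube]
    refine cube_subset_cube ?_
    have h1 : ((⌈‖n‖⌉₊ + r : ℕ) : ℝ) ≤ L := by exact_mod_cast h
    push_cast at h1
    rw [sub_zero]
    linarith [Nat.le_ceil ‖n‖]
  refine Metric.cauchySeq_iff'.2 fun ε hε => ?_
  obtain ⟨r, hr⟩ := exists_nat_gt (2 * C / ε)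
  have hC0 : 0 ≤ C := sq_nonneg _
  have hr0 : (0 : ℝ) < r := lt_of_le_of_lt (by positivity) hr
  have hr0' : 0 < r := by exact_mod_cast hr0
  refine ⟨⌈‖n‖⌉₊ + r, fun L hL => ?_⟩
  have h1 := norm_expGroup_boxOp_sub_le hr0' (hsub r L hL) ω t
  have h2 := norm_expGroup_boxOp_sub_le hr0' (hsub r _ le_rfl) ω t
  rw [dist_eq_norm]
  calc _ ≤ C / r + C / r := by
        refine (norm_sub_le_norm_sub_add_norm_sub _
          (expGroup (boxOp (cube n r) ω) t (basisVec n)) _).trans (add_le_add h1 ?_)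
        rw [norm_sub_rev]
        exact h2
    _ = 2 * C / r := by ring
    _ < ε := by rwa [div_lt_comm₀ hr0 hε]

theorem cauchySeq_boxGroup (ω : Lattice d → ℝ) (t : ℝ) (u : Hilb d) :
    CauchySeq fun L => boxGroup ω L t u := by
  let K : Submodule ℂ (Hilb d) :=
    { carrier := {u | CauchySeq fun L => boxGroup ω L t u}
      add_mem' := fun {u v} hu hv => by
        simp only [Set.mem_ofPred_eq, map_add] at *
        exact hu.add hv
      zero_mem' := by
        simp only [Set.mem_ofPred_eq, map_zero]
        exact cauchySeq_const 0
      smul_mem' := fun c u hu => by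
        simp only [Set.mem_ofPred_eq, map_smul] at *
        exact (uniformContinuous_const_smul c).comp_cauchySeq hu }
  refine mem_of_basisVec_mem (K := K) ?_ (cauchySeq_boxGroup_basisVec ω t) u
  refine isClosed_of_closure_subset fun v hv => ?_
  refine Metric.cauchySeq_iff'.2 fun ε hε => ?_
  obtain ⟨w, hw, hvw⟩ := Metric.mem_closure_iff.1 hv (ε / 4) (by positivity)
  obtain ⟨N, hN⟩ := Metric.cauchySeq_iff'.1 hw (ε / 4) (by positivity)
  refine ⟨N, fun L hL => ?_⟩
  have e : ∀ L, dist (boxGroup ω L t v) (boxGroup ω L t w) < ε / 4 := by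
    intro L
    rw [dist_eq_norm, ← map_sub, norm_boxGroup_apply, ← dist_eq_norm]
    exact hvw
  have h4 := dist_triangle4 (boxGroup ω L t v) (boxGroup ω L t w) (boxGroup ω N t w)
    (boxGroup ω N t v)
  have h5 := e N
  rw [dist_comm] at h5
  linarith [e L, hN L hL]

/-- The evolution in infinite volume, as the strong limit of the evolutions in the boxes. -/
noncomputable def infGroup (ω : Lattice d → ℝ) (t : ℝ) : Hilb d →L[ℂ] Hilb d :=
  continuousLinearMapOfTendsto (fun L => boxGroup ω L t)
    (f := fun u => (cauchySeq_tendsto_of_complete (cauchySeq_boxGroup ω t u)).choose)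
    (tendsto_pi_nhds.2 fun u =>
      (cauchySeq_tendsto_of_complete (cauchySeq_boxGroup ω t u)).choose_spec)

theorem tendsto_boxGroup (ω : Lattice d → ℝ) (t : ℝ) (u : Hilb d) :
    Tendsto (fun L => boxGroup ω L t u) atTop (𝓝 (infGroup ω t u)) :=
  (cauchySeq_tendsto_of_complete (cauchySeq_boxGroup ω t u)).choose_spec

theorem norm_infGroup_apply (ω : Lattice d → ℝ) (t : ℝ) (u : Hilb d) : ‖infGroup ω t u‖ = ‖u‖ :=
  tendsto_nhds_unique (tendsto_boxGroup ω t u).norm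
    (tendsto_const_nhds.congr fun L => (norm_boxGroup_apply ω L t u).symm)

theorem infGroup_zero (ω : Lattice d → ℝ) : infGroup ω 0 = 1 := by
  ext1 u
  refine tendsto_nhds_unique (tendsto_boxGroup ω 0 u) ?_
  simp [boxGroup, expGroup_zero]

theorem infGroup_add (ω : Lattice d → ℝ) (s t : ℝ) :
    infGroup ω (s + t) = infGroup ω s * infGroup ω t := by
  ext1 u
  refine tendsto_nhds_unique (tendsto_boxGroup ω (s + t) u) ?_
  have h1 : Tendsto (fun L => boxGroup ω L s (boxGroup ω L t u - infGroup ω t u)) atTop (𝓝 0) := by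
    rw [tendsto_zero_iff_norm_tendsto_zero]
    simp only [norm_boxGroup_apply]
    rw [← tendsto_zero_iff_norm_tendsto_zero, ← sub_self (infGroup ω t u)]
    exact (tendsto_boxGroup ω t u).sub_const _
  have h2 := h1.add (tendsto_boxGroup ω s (infGroup ω t u))
  rw [zero_add] at h2
  refine h2.congr fun L => ?_
  rw [map_sub, sub_add_cancel, boxGroup, boxGroup, boxGroup, expGroup_add, mul_apply_eq_comp]

theorem inner_boxGroup (ω : Lattice d → ℝ) (L : ℕ) (t : ℝ) (u v : Hilb d) :
    inner ℂ (boxGroup ω L t u) v = inner ℂ u (boxGroup ω L (-t) v) := by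
  have h := ContinuousLinearMap.inner_map_map_of_mem_unitary
    (expGroup_mem_unitary (boxOp_isSelfAdjoint (box d L) ω) t) u (boxGroup ω L (-t) v)
  rw [← h, boxGroup, boxGroup, ← mul_apply_eq_comp, ← expGroup_add]
  simp [expGroup_zero]

theorem inner_infGroup (ω : Lattice d → ℝ) (t : ℝ) (u v : Hilb d) :
    inner ℂ (infGroup ω t u) v = inner ℂ u (infGroup ω (-t) v) :=
  tendsto_nhds_unique ((tendsto_boxGroup ω t u).inner tendsto_const_nhds)
    ((tendsto_const_nhds.inner (tendsto_boxGroup ω (-t) v)).congr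
      fun L => (inner_boxGroup ω L t u v).symm)

theorem infGroup_mem_unitary (ω : Lattice d → ℝ) (t : ℝ) :
    infGroup ω t ∈ unitary (Hilb d →L[ℂ] Hilb d) := by
  have h : star (infGroup ω t) = infGroup ω (-t) := by
    rw [ContinuousLinearMap.star_eq_adjoint]
    refine ((ContinuousLinearMap.eq_adjoint_iff _ _).2 fun u v => ?_).symm
    rw [inner_infGroup, neg_neg]
  rw [Unitary.mem_iff, h, ← infGroup_add, ← infGroup_add]
  simp [infGroup_zero]

theorem continuous_infGroup_apply (ω : Lattice d → ℝ) (u : Hilb d) :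
    Continuous fun t => infGroup ω t u := by
  let K : Submodule ℂ (Hilb d) :=
    { carrier := {u | Continuous fun t => infGroup ω t u}
      add_mem' := fun {u v} hu hv => by
        simp only [Set.mem_ofPred_eq, map_add] at *
        exact hu.add hv
      zero_mem' := by
        simp only [Set.mem_ofPred_eq, map_zero]
        exact continuous_const
      smul_mem' := fun c u hu => by
        simp only [Set.mem_ofPred_eq, map_smul] at *
        exact hu.const_smul c }
  refine mem_of_basisVec_mem (K := K) ?_ (fun n => ?_) u
  · refine isClosed_of_closure_subset fun v hv => ?_
    refine continuous_of_uniform_approx_of_continuous fun s hs => ?_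
    obtain ⟨ε, hε, hεs⟩ := Metric.mem_uniformity_dist.1 hs
    obtain ⟨w, hw, hvw⟩ := Metric.mem_closure_iff.1 hv ε hε
    refine ⟨fun t => infGroup ω t w, hw, fun t => ?_⟩
    refine hεs ?_
    rw [dist_eq_norm, ← map_sub, norm_infGroup_apply, ← dist_eq_norm]
    exact hvw
  · refine LipschitzWith.continuous (K := Real.toNNReal (2 * d + |ω n|)) ?_
    refine LipschitzWith.of_dist_le_mul fun s t => ?_
    rw [dist_eq_norm, Real.dist_eq, Real.coe_toNNReal _ (by positivity), mul_comm]
    refine le_of_tendsto ((tendsto_boxGroup ω s _).sub (tendsto_boxGroup ω t _)).norm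
      (Eventually.of_forall fun L => ?_)
    exact (norm_expGroup_sub_le (boxOp_isSelfAdjoint _ ω) _ s t).trans
      (mul_le_mul_of_nonneg_left (norm_boxOp_basisVec_le _ ω n) (abs_nonneg _))

/-- The sum over nearest neighbours, as a bounded operator. -/
noncomputable def hop : Hilb d →L[ℂ] Hilb d := ∑ p : Fin d × Bool, shift (step p)

theorem hop_apply (u : Hilb d) (n : Lattice d) : hop u n = ∑ p, u (n + step p) := by
  rw [hop, sum_apply, lp.coeFn_sum, Finset.sum_apply]
  rfl

theorem star_hop : star (hop : Hilb d →L[ℂ] Hilb d) = hop := by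
  rw [hop, star_sum]
  simp only [star_shift]
  rw [sum_step (fun a => shift (-a)), sum_step (fun a => shift a)]
  refine Finset.sum_congr rfl fun i _ => ?_
  rw [neg_neg, add_comm]

theorem formalOp_eq_hop (ω : Lattice d → ℝ) (u : Hilb d) (n : Lattice d) :
    formalOp ω u n = hop u n + ω n * u n := by
  rw [hop_apply, sum_step fun a => u (n + a)]
  simp [formalOp, sub_eq_add_neg]

theorem mem_graph_hamiltonian {ω : Lattice d → ℝ} {u v : Hilb d} :
    (u, v) ∈ (hamiltonian ω).graph ↔ ∀ n, v n = hop u n + ω n * u n := by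
  rw [LinearPMap.mem_graph_iff]
  constructor
  · rintro ⟨y, h1, h2⟩ n
    simp only at h1 h2
    subst h1 h2
    exact formalOp_eq_hop ω _ n
  · intro h
    have hv : (v : Lattice d → ℂ) = formalOp ω (u : Lattice d → ℂ) :=
      funext fun n => by rw [h n, formalOp_eq_hop]
    have hmem : u ∈ (hamiltonian ω).domain := by
      change Memℓp (formalOp ω (u : Lattice d → ℂ)) 2
      rw [← hv]
      exact v.2
    exact ⟨⟨u, hmem⟩, rfl, Subtype.ext hv.symm⟩

/-- The image of `e_n` under the Hamiltonian. -/
noncomputable def column (ω : Lattice d → ℝ) (n : Lattice d) : Hilb d :=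
  hop (basisVec n) + (ω n : ℂ) • basisVec n

theorem column_mem_graph (ω : Lattice d → ℝ) (n : Lattice d) :
    (basisVec n, column ω n) ∈ (hamiltonian ω).graph := by
  refine mem_graph_hamiltonian.2 fun m => ?_
  rw [column, lp.coeFn_add, Pi.add_apply, lp.coeFn_smul, Pi.smul_apply, basisVec_apply]
  split_ifs with h
  · rw [h, smul_eq_mul]
  · simp

theorem dense_domain_hamiltonian (ω : Lattice d → ℝ) :
    Dense ((hamiltonian ω).domain : Set (Hilb d)) := by
  intro u
  refine mem_of_basisVec_mem (K := (hamiltonian ω).domain.topologicalClosure)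
    (Submodule.isClosed_topologicalClosure _) (fun n => ?_) u
  exact Submodule.le_topologicalClosure _
    (LinearPMap.mem_domain_iff.2 ⟨_, column_mem_graph ω n⟩)

theorem boxOp_basisVec {ω : Lattice d → ℝ} {n : Lattice d} {L : ℕ} (h : ‖n‖ + 1 ≤ L) :
    boxOp (box d L) ω (basisVec n) = column ω n := by
  have hmem : ∀ m, ‖m‖ ≤ ‖n‖ + 1 → m ∈ box d L := by
    intro m hm
    rw [box_eq_cube, mem_cube_iff_norm, sub_zero]
    exact hm.trans h
  ext m
  rw [boxOp_apply_eq_formalOp, formalOp_eq_hop,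
    ← mem_graph_hamiltonian.1 (column_mem_graph ω n) m]
  · refine ite_eq_left_iff.2 fun hm => ?_
    have h1 : m ≠ n := by
      rintro rfl
      exact hm (hmem _ (by linarith))
    have h2 : ∀ p, m + step p ≠ n := by
      rintro p rfl
      refine hm (hmem _ ?_)
      have := norm_sub_le (m + step p) (step p)
      rw [add_sub_cancel_right] at this
      linarith [norm_step p]
    rw [mem_graph_hamiltonian.1 (column_mem_graph ω n) m, hop_apply]
    simp [basisVec_apply, h1, h2]
  · intro m hm
    rw [basisVec_apply, if_neg]
    rintro rfl
    exact hm (hmem _ (by linarith))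

/-- The integrated Schrödinger equation for `e_n`: it holds in all large boxes, as the Hamiltonian
maps `e_n` to a vector supported near `n`. -/
theorem infGroup_basisVec_eq_integral (ω : Lattice d → ℝ) (n : Lattice d) (t : ℝ) :
    infGroup ω t (basisVec n) =
      basisVec n + ∫ s in (0 : ℝ)..t, infGroup ω s (-(Complex.I • column ω n)) := by
  have hcont : ∀ L, Continuous fun s => boxGroup ω L s (-(Complex.I • column ω n)) := by
    intro L
    exact (continuous_iff_continuousAt.2 fun s => (hasDerivAt_expGroup
      (boxOp (box d L) ω) s).continuousAt).clm_apply continuous_const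
  have hfin : ∀ L : ℕ, ‖n‖ + 1 ≤ L → boxGroup ω L t (basisVec n) =
      basisVec n + ∫ s in (0 : ℝ)..t, boxGroup ω L s (-(Complex.I • column ω n)) := by
    intro L hL
    have hd : ∀ s : ℝ, HasDerivAt (fun s => boxGroup ω L s (basisVec n))
        (boxGroup ω L s (-(Complex.I • column ω n))) s := by
      intro s
      have := ((ContinuousLinearMap.apply ℂ (Hilb d) (basisVec n)).restrictScalars
        ℝ).hasFDerivAt.comp_hasDerivAt s (hasDerivAt_expGroup (boxOp (box d L) ω) s)
      refine this.congr_deriv ?_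
      simp [boxGroup, boxOp_basisVec hL]
    rw [intervalIntegral.integral_eq_sub_of_hasDerivAt (fun s _ => hd s)
      ((hcont L).intervalIntegrable _ _)]
    simp [boxGroup, expGroup_zero]
  refine tendsto_nhds_unique (tendsto_boxGroup ω t _) ?_
  have hlim : Tendsto (fun L => basisVec n + ∫ s in (0 : ℝ)..t,
      boxGroup ω L s (-(Complex.I • column ω n))) atTop (𝓝 (basisVec n +
        ∫ s in (0 : ℝ)..t, infGroup ω s (-(Complex.I • column ω n)))) := by
    refine tendsto_const_nhds.add ?_
    refine intervalIntegral.tendsto_integral_filter_of_dominated_convergence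
      (fun _ => ‖-(Complex.I • column ω n)‖) (Eventually.of_forall fun L =>
        (hcont L).aestronglyMeasurable) (Eventually.of_forall fun L => ae_of_all _ fun s _ => ?_)
      intervalIntegrable_const (ae_of_all _ fun s _ => tendsto_boxGroup ω s _)
    rw [norm_boxGroup_apply]
  refine hlim.congr' ?_
  filter_upwards [eventually_ge_atTop ⌈‖n‖ + 1⌉₊] with L hL
  exact (hfin L ((Nat.le_ceil _).trans (by exact_mod_cast hL))).symm

/-- The finitely supported vectors form a core of the Hamiltonian: cut `u` off to large boxes. -/
theorem infGroup_eq_integral {ω : Lattice d → ℝ} {u v : Hilb d}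
    (h : (u, v) ∈ (hamiltonian ω).graph) (t : ℝ) :
    infGroup ω t u = u + ∫ s in (0 : ℝ)..t, infGroup ω s (-(Complex.I • v)) := by
  have hint : ∀ w : Hilb d, IntervalIntegrable (fun s => infGroup ω s (-(Complex.I • w)))
      volume 0 t := fun w => (continuous_infGroup_apply ω _).intervalIntegrable _ _
  let J : Hilb d →ₗ[ℂ] Hilb d :=
    { toFun := fun w => ∫ s in (0 : ℝ)..t, infGroup ω s (-(Complex.I • w))
      map_add' := fun w w' => by
        rw [← intervalIntegral.integral_add (hint w) (hint w')]
        simp [smul_add, add_comm]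
      map_smul' := fun c w => by
        rw [RingHom.id_apply, ← intervalIntegral.integral_smul]
        congr 1
        funext s
        rw [← map_smul, smul_neg, smul_comm] }
  have hJ : Continuous J := by
    refine (J.mkContinuous |t| fun w => ?_).continuous
    have := intervalIntegral.norm_integral_le_of_norm_le_const (a := 0) (b := t) (C := ‖w‖)
      (f := fun s => infGroup ω s (-(Complex.I • w))) (fun s _ => by
        rw [norm_infGroup_apply, norm_neg, norm_smul, Complex.norm_I, one_mul])
    rw [sub_zero, mul_comm] at this
    exact this
  have hfin : ∀ S : Finset (Lattice d), infGroup ω t (diagOn S 1 u) =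
      diagOn S 1 u + J (hop (diagOn S 1 u) + diagOn S 1 (v - hop u)) := by
    intro S
    have e : hop (diagOn S 1 u) + diagOn S 1 (v - hop u) = ∑ n ∈ S, u n • column ω n := by
      rw [diagOn_one_eq_sum, diagOn_one_eq_sum, map_sum, ← Finset.sum_add_distrib]
      refine Finset.sum_congr rfl fun n _ => ?_
      rw [lp.coeFn_sub, Pi.sub_apply, mem_graph_hamiltonian.1 h n, add_sub_cancel_left, column,
        smul_add, map_smul, smul_smul, mul_comm (u n)]
    rw [e, diagOn_one_eq_sum, map_sum, map_sum, ← Finset.sum_add_distrib]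
    refine Finset.sum_congr rfl fun n _ => ?_
    rw [map_smul, map_smul, infGroup_basisVec_eq_integral, smul_add]
    rfl
  refine tendsto_nhds_unique
    (((infGroup ω t).continuous.tendsto u).comp (tendsto_diagOn_box u)) ?_
  have h1 : Tendsto (fun L : ℕ => hop (diagOn (box d L) 1 u) + diagOn (box d L) 1 (v - hop u))
      atTop (𝓝 v) := by
    have := (((hop : Hilb d →L[ℂ] Hilb d).continuous.tendsto u).comp (tendsto_diagOn_box u)).add
      (tendsto_diagOn_box (v - hop u))
    rwa [add_sub_cancel] at this
  exact ((tendsto_diagOn_box u).add ((hJ.tendsto v).comp h1)).congr fun L => (hfin _).symm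

/-- The limit of the finite-volume evolutions is the unitary group generated by the Hamiltonian on
its maximal domain. That no larger domain is possible follows by testing against the `e_n`. -/
theorem infGroup_isUnitaryGroupOf (ω : Lattice d → ℝ) :
    IsUnitaryGroupOf (hamiltonian ω) (infGroup ω) where
  map_zero := infGroup_zero ω
  map_add := infGroup_add ω
  mem_unitary := infGroup_mem_unitary ω
  strongly_continuous := continuous_infGroup_apply ω
  generator := by
    have forward : ∀ u v : Hilb d, (u, v) ∈ (hamiltonian ω).graph →
        HasDerivAt (fun t : ℝ => infGroup ω t u) (-(Complex.I • v)) 0 := by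
      intro u v h
      have h1 := ((continuous_infGroup_apply ω (-(Complex.I • v))).integral_hasStrictDerivAt
        0 0).hasDerivAt.const_add u
      simp only [infGroup_zero, one_apply_eq_self] at h1
      exact h1.congr_of_eventuallyEq (Eventually.of_forall fun t => infGroup_eq_integral h t)
    refine fun u v => ⟨forward u v, fun h => ?_⟩
    -- pair with `e_n` and move the group to the other side
    refine mem_graph_hamiltonian.2 fun n => ?_
    have h1 : HasDerivAt (fun t : ℝ => inner ℂ (basisVec n) (infGroup ω t u))
        (inner ℂ (basisVec n) (-(Complex.I • v))) 0 := by
      simpa using (hasDerivAt_const (0 : ℝ) (basisVec n : Hilb d)).inner ℂ h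
    have h2 : HasDerivAt (fun t : ℝ => infGroup ω (-t) (basisVec n))
        (Complex.I • column ω n) 0 := by
      have := forward _ _ (column_mem_graph ω n)
      have h3 := HasDerivAt.scomp (0 : ℝ) (h := fun t : ℝ => -t) (h' := -1)
        (by simpa using this) (hasDerivAt_neg 0)
      simpa [Function.comp_def] using h3
    have h3 : HasDerivAt (fun t : ℝ => inner ℂ (infGroup ω (-t) (basisVec n)) u)
        (inner ℂ (Complex.I • column ω n) u) 0 := by
      have := h2.inner ℂ (hasDerivAt_const (0 : ℝ) u)
      rwa [inner_zero_right, zero_add] at this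
    have e : (fun t : ℝ => inner ℂ (infGroup ω (-t) (basisVec n)) u) =
        fun t : ℝ => inner ℂ (basisVec n) (infGroup ω t u) := by
      funext t
      rw [inner_infGroup, neg_neg]
    rw [e] at h3
    have h4 := h1.unique h3
    have h5 : inner ℂ (column ω n) u = hop u n + ω n * u n := by
      rw [column, inner_add_left, inner_smul_left, Complex.conj_ofReal, inner_basisVec_left]
      congr 1
      rw [← inner_basisVec_left n (hop u)]
      conv_rhs => rw [← star_hop, ContinuousLinearMap.star_eq_adjoint,
        ContinuousLinearMap.adjoint_inner_right]
    rw [inner_neg_right, inner_smul_right, inner_smul_left, inner_basisVec_left, Complex.conj_I,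
      h5] at h4
    linear_combination Complex.I * h4 + (v n - (hop u n + ω n * u n)) * Complex.I_sq

theorem expNegI_hamiltonian (ω : Lattice d → ℝ) : expNegI (hamiltonian ω) = infGroup ω :=
  (infGroup_isUnitaryGroupOf ω).expNegI_eq (dense_domain_hamiltonian ω)

theorem tendsto_returnAmp_box (ω : Lattice d → ℝ) (t : ℝ) :
    Tendsto (fun L => returnAmp (box d L) ω t 0) atTop
      (𝓝 (inner ℂ (basisVec 0) (infGroup ω t (basisVec 0)))) :=
  tendsto_const_nhds.inner (tendsto_boxGroup ω t (basisVec 0))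

end Anderson

/-! ### A law of large numbers for local observables of an i.i.d. potential -/

namespace Anderson

variable {d : ℕ}

/-- The average of `f` over the box `Λ_L`. -/
noncomputable def boxAvg (f : Lattice d → ℂ) (L : ℕ) : ℂ :=
  (∑ n ∈ box d L, f n) / ((2 * L + 1 : ℕ) : ℂ) ^ d

theorem card_box (d L : ℕ) : (box d L).card = (2 * L + 1) ^ d := by
  rw [box_eq_cube, card_cube]

theorem box_subset_box {L L' : ℕ} (h : L ≤ L') : box d L ⊆ box d L' := by
  rw [box_eq_cube, box_eq_cube]
  exact cube_subset_cube (by simpa using h)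

theorem norm_boxAvg (f : Lattice d → ℂ) (L : ℕ) :
    ‖boxAvg f L‖ = ‖∑ n ∈ box d L, f n‖ / ((2 * L + 1 : ℕ) : ℝ) ^ d := by
  rw [boxAvg, norm_div, norm_pow, Complex.norm_natCast]

theorem boxAvg_sub (f g : Lattice d → ℂ) (L : ℕ) :
    boxAvg (fun n => f n - g n) L = boxAvg f L - boxAvg g L := by
  rw [boxAvg, boxAvg, boxAvg, Finset.sum_sub_distrib, sub_div]

theorem boxAvg_const (c : ℂ) (L : ℕ) : boxAvg (fun _ : Lattice d => c) L = c := by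
  rw [boxAvg, Finset.sum_const, card_box, nsmul_eq_mul, Nat.cast_pow, mul_div_cancel_left₀]
  exact pow_ne_zero _ (Nat.cast_ne_zero.2 (by omega))

/-- Averages of a bounded function over the boxes of side `2 K² + 1` and `2 L + 1` are close if
`K = ⌊√L⌋`. -/
theorem norm_boxAvg_le_sqrt {f : Lattice d → ℂ} {M : ℝ} (hf : ∀ n, ‖f n‖ ≤ M) {L : ℕ}
    (hL : 0 < Nat.sqrt L) :
    ‖boxAvg f L‖ ≤ ‖boxAvg f (Nat.sqrt L * Nat.sqrt L)‖ + M * (d * (2 / Nat.sqrt L)) := by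
  have hM : 0 ≤ M := (norm_nonneg _).trans (hf 0)
  set K := Nat.sqrt L with hK
  have h1 : K * K ≤ L := Nat.sqrt_le L
  have h2 : L < (K + 1) * (K + 1) := Nat.lt_succ_sqrt L
  have hK0 : (0 : ℝ) < K := by exact_mod_cast hL
  set a : ℝ := ((2 * (K * K) + 1 : ℕ) : ℝ) with ha
  set b : ℝ := ((2 * L + 1 : ℕ) : ℝ) with hb
  have ha0 : 0 < a := by rw [ha]; exact_mod_cast Nat.succ_pos _
  have hb0 : 0 < b := by rw [hb]; exact_mod_cast Nat.succ_pos _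
  have hab : a ≤ b := by
    rw [ha, hb]
    exact_mod_cast (by omega : 2 * (K * K) + 1 ≤ 2 * L + 1)
  have hsum : ‖∑ n ∈ box d L, f n‖ ≤ ‖∑ n ∈ box d (K * K), f n‖ + M * (b ^ d - a ^ d) := by
    rw [← Finset.sum_sdiff (box_subset_box h1), add_comm]
    refine (norm_add_le _ _).trans (add_le_add_right ?_ _)
    refine (norm_sum_le _ _).trans ((Finset.sum_le_sum fun n _ => hf n).trans (le_of_eq ?_))
    rw [Finset.sum_const, Finset.card_sdiff_of_subset (box_subset_box h1), card_box, card_box,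
      nsmul_eq_mul, Nat.cast_sub (Nat.pow_le_pow_left (by omega) d), Nat.cast_pow, Nat.cast_pow]
    ring
  have hratio : 1 - d * (2 / (K : ℝ)) ≤ (a / b) ^ d := by
    have h3 : 1 - 2 / (K : ℝ) ≤ a / b := by
      rw [le_div_iff₀ hb0]
      have h4 : b ≤ a + 4 * K := by
        rw [ha, hb]
        have : L ≤ K * K + 2 * K := by nlinarith
        exact_mod_cast (by omega : 2 * L + 1 ≤ 2 * (K * K) + 1 + 4 * K)
      have h5 : 2 * (K : ℝ) * K ≤ b := by
        refine le_trans ?_ hab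
        rw [ha]
        push_cast
        linarith
      have h6 : 4 * (K : ℝ) ≤ 2 / (K : ℝ) * b := by
        rw [div_mul_eq_mul_div, le_div_iff₀ hK0]
        linarith
      linarith
    have h : 2 / (K : ℝ) ≤ 2 := by
      rw [div_le_iff₀ hK0]
      have : (1 : ℝ) ≤ K := by exact_mod_cast hL
      linarith
    have h8 := one_add_mul_le_pow (by linarith : -2 ≤ -(2 / (K : ℝ))) d
    rcases le_or_gt 0 (1 + -(2 / (K : ℝ))) with h9 | h9
    · linarith [pow_le_pow_left₀ h9 (by linarith : 1 + -(2 / (K : ℝ)) ≤ a / b) d]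
    · rcases Nat.eq_zero_or_pos d with rfl | hd
      · simp
      · have hd1 : (1 : ℝ) ≤ d := by exact_mod_cast hd
        have : 0 ≤ (a / b) ^ d := by positivity
        nlinarith
  rw [norm_boxAvg, norm_boxAvg, div_le_iff₀ (by positivity)]
  refine hsum.trans ?_
  rw [add_mul]
  refine add_le_add ?_ ?_
  · rw [div_mul_eq_mul_div, le_div_iff₀ (by positivity)]
    exact mul_le_mul_of_nonneg_left (pow_le_pow_left₀ ha0.le hab d) (norm_nonneg _)
  · rw [mul_assoc]
    refine mul_le_mul_of_nonneg_left ?_ hM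
    rw [div_pow, le_div_iff₀ (by positivity)] at hratio
    linarith

/-- Convergence of the averages along the boxes `Λ_{K²}` suffices. -/
theorem tendsto_boxAvg_of_squares {f : Lattice d → ℂ} {M : ℝ} (hf : ∀ n, ‖f n‖ ≤ M)
    (h : Tendsto (fun K : ℕ => boxAvg f (K * K)) atTop (𝓝 0)) :
    Tendsto (boxAvg f) atTop (𝓝 0) := by
  have hsqrt : Tendsto Nat.sqrt atTop atTop :=
    tendsto_atTop_atTop.2 fun b => ⟨b * b, fun a ha => Nat.le_sqrt.2 ha⟩
  have h1 : Tendsto (fun K : ℕ => ‖boxAvg f (K * K)‖ + M * (d * (2 / (K : ℝ)))) atTop (𝓝 0) := by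
    have h2 := tendsto_const_div_atTop_nhds_zero_nat (2 : ℝ)
    simpa using h.norm.add ((h2.const_mul (d : ℝ)).const_mul M)
  refine squeeze_zero_norm' ?_ (h1.comp hsqrt)
  filter_upwards [hsqrt.eventually_gt_atTop 0] with L hL
  exact norm_boxAvg_le_sqrt hf hL

instance (μ : Measure ℝ) [IsProbabilityMeasure μ] : IsProbabilityMeasure (potentialLaw d μ) := by
  unfold potentialLaw
  infer_instance

section LawOfLargeNumbers

variable (μ : Measure ℝ) [IsProbabilityMeasure μ]

/-- The translated potential. -/
def translate (n : Lattice d) (ω : Lattice d → ℝ) : Lattice d → ℝ := fun m => ω (m + n)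

theorem measurable_translate (n : Lattice d) : Measurable (translate n) := by
  unfold translate
  fun_prop

theorem measurePreserving_translate (n : Lattice d) :
    MeasurePreserving (translate n) (potentialLaw d μ) (potentialLaw d μ) :=
  ⟨measurable_translate n, Measure.map_infinitePi_infinitePi_of_inj (P := fun _ : Lattice d => μ)
    (f := fun m => m + n) (add_left_injective n)⟩

theorem integral_translate {F : (Lattice d → ℝ) → ℂ} (hF : Measurable F) (n : Lattice d) :
    ∫ ω, F (translate n ω) ∂(potentialLaw d μ) = ∫ ω, F ω ∂(potentialLaw d μ) := by
  conv_rhs => rw [← (measurePreserving_translate μ n).map_eq]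
  rw [integral_map (measurable_translate n).aemeasurable hF.aestronglyMeasurable]

/-- Observables of disjoint regions are independent. -/
theorem indepFun_of_local {F G : (Lattice d → ℝ) → ℂ} (hF : Measurable F) (hG : Measurable G)
    {S T : Finset (Lattice d)} (hST : Disjoint S T)
    (hFS : ∀ ω ω' : Lattice d → ℝ, (∀ n ∈ S, ω n = ω' n) → F ω = F ω')
    (hGT : ∀ ω ω' : Lattice d → ℝ, (∀ n ∈ T, ω n = ω' n) → G ω = G ω') :
    IndepFun F G (potentialLaw d μ) := by
  classical
  have h1 : iIndepFun (fun (n : Lattice d) (ω : Lattice d → ℝ) => ω n) (potentialLaw d μ) :=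
    iIndepFun_infinitePi (P := fun _ : Lattice d => μ) (X := fun _ x => x)
      (fun _ => measurable_id)
  have h2 := h1.indepFun_finset S T hST (fun n => measurable_pi_apply n)
  let ext (S : Finset (Lattice d)) (η : S → ℝ) : Lattice d → ℝ :=
    fun n => if h : n ∈ S then η ⟨n, h⟩ else 0
  have hext : ∀ S, Measurable (ext S) := by
    refine fun S => measurable_pi_lambda _ fun n => ?_
    by_cases h : n ∈ S
    · simp only [ext, h, dif_pos]
      exact measurable_pi_apply _
    · simp only [ext, h, dif_neg, not_false_eq_true]
      exact measurable_const
  have h3 := h2.comp (hF.comp (hext S)) (hG.comp (hext T))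
  refine h3.congr (ae_of_all _ fun ω => hFS _ _ fun n hn => ?_)
    (ae_of_all _ fun ω => hGT _ _ fun n hn => ?_)
  · simp [ext, hn]
  · simp [ext, hn]

variable {F : (Lattice d → ℝ) → ℂ} {R : ℕ} {M : ℝ}

/-- Centred local observables at distant sites are uncorrelated. -/
theorem integral_translate_mul_conj_eq_zero (hF : Measurable F)
    (hloc : ∀ ω ω' : Lattice d → ℝ, (∀ n ∈ cube 0 R, ω n = ω' n) → F ω = F ω')
    (h0 : ∫ ω, F ω ∂(potentialLaw d μ) = 0) {m n : Lattice d} (hmn : n ∉ cube m (2 * R)) :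
    ∫ ω, F (translate m ω) * (starRingEnd ℂ) (F (translate n ω)) ∂(potentialLaw d μ) = 0 := by
  have hmeas : ∀ n, Measurable fun ω => F (translate n ω) := fun n =>
    hF.comp (measurable_translate n)
  have hmeas' : ∀ n, Measurable fun ω => (starRingEnd ℂ) (F (translate n ω)) := fun n =>
    Complex.continuous_conj.measurable.comp (hmeas n)
  have hl : ∀ n : Lattice d, ∀ ω ω' : Lattice d → ℝ, (∀ k ∈ cube n R, ω k = ω' k) →
      F (translate n ω) = F (translate n ω') := by
    intro n ω ω' h
    refine hloc _ _ fun k hk => h _ ?_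
    rw [mem_cube_iff_norm] at hk ⊢
    simpa using hk
  have hdisj : Disjoint (cube m R) (cube n R) := by
    rw [Finset.disjoint_left]
    intro k hk hk'
    rw [mem_cube_iff_norm] at hk hk' hmn
    refine hmn ?_
    calc ‖n - m‖ = ‖(k - m) - (k - n)‖ := by congr 1; abel
      _ ≤ ‖k - m‖ + ‖k - n‖ := norm_sub_le _ _
      _ ≤ _ := by push_cast; linarith
  have hind := indepFun_of_local μ (hmeas m) (hmeas' n) hdisj (hl m)
    (fun ω ω' h => by rw [hl n ω ω' h])
  rw [hind.integral_fun_mul_eq_mul_integral (hmeas m).aestronglyMeasurable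
    (hmeas' n).aestronglyMeasurable, integral_translate μ hF, h0, zero_mul]

/-- Only pairs of sites at distance at most `2 R` contribute to the second moment. -/
theorem integral_norm_sq_sum_translate_le (hF : Measurable F) (hM : ∀ ω, ‖F ω‖ ≤ M)
    (hloc : ∀ ω ω' : Lattice d → ℝ, (∀ n ∈ cube 0 R, ω n = ω' n) → F ω = F ω')
    (h0 : ∫ ω, F ω ∂(potentialLaw d μ) = 0) (L : ℕ) :
    ∫ ω, ‖∑ n ∈ box d L, F (translate n ω)‖ ^ 2 ∂(potentialLaw d μ) ≤
      ((2 * L + 1 : ℕ) : ℝ) ^ d * (((2 * (2 * R) + 1 : ℕ) : ℝ) ^ d * M ^ 2) := by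
  have hmeas : ∀ n, Measurable fun ω => F (translate n ω) := fun n =>
    hF.comp (measurable_translate n)
  have hmeas' : ∀ n, Measurable fun ω => (starRingEnd ℂ) (F (translate n ω)) := fun n =>
    Complex.continuous_conj.measurable.comp (hmeas n)
  have hbd : ∀ m n ω, ‖F (translate m ω) * (starRingEnd ℂ) (F (translate n ω))‖ ≤ M ^ 2 := by
    intro m n ω
    rw [norm_mul, RCLike.norm_conj, sq]
    exact mul_le_mul (hM _) (hM _) (norm_nonneg _) ((norm_nonneg _).trans (hM ω))
  have hint : ∀ m n, Integrable
      (fun ω => F (translate m ω) * (starRingEnd ℂ) (F (translate n ω))) (potentialLaw d μ) :=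
    fun m n => Integrable.of_bound ((hmeas m).mul (hmeas' n)).aestronglyMeasurable (M ^ 2)
      (ae_of_all _ (hbd m n))
  have hterm : ∀ m n : Lattice d,
      ‖∫ ω, F (translate m ω) * (starRingEnd ℂ) (F (translate n ω)) ∂(potentialLaw d μ)‖ ≤
        if n ∈ cube m (2 * R) then M ^ 2 else 0 := by
    intro m n
    split_ifs with h
    · refine (norm_integral_le_of_norm_le_const (ae_of_all _ (hbd m n))).trans ?_
      simp
    · rw [integral_translate_mul_conj_eq_zero μ hF hloc h0 h, norm_zero]
  have e : ((∫ ω, ‖∑ n ∈ box d L, F (translate n ω)‖ ^ 2 ∂(potentialLaw d μ) : ℝ) : ℂ) =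
      ∑ m ∈ box d L, ∑ n ∈ box d L,
        ∫ ω, F (translate m ω) * (starRingEnd ℂ) (F (translate n ω)) ∂(potentialLaw d μ) := by
    rw [← integral_complex_ofReal]
    simp_rw [← integral_finsetSum (box d L) (fun n _ => hint _ n)]
    rw [← integral_finsetSum _ (fun m _ => integrable_finsetSum _ fun n _ => hint m n)]
    congr 1
    funext ω
    rw [Complex.ofReal_pow, ← Complex.mul_conj', map_sum, Finset.sum_mul_sum]
  have h1 : ‖((∫ ω, ‖∑ n ∈ box d L, F (translate n ω)‖ ^ 2 ∂(potentialLaw d μ) : ℝ) : ℂ)‖ ≤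
      ∑ m ∈ box d L, ∑ n ∈ box d L, if n ∈ cube m (2 * R) then M ^ 2 else 0 := by
    rw [e]
    exact (norm_sum_le _ _).trans (Finset.sum_le_sum fun m _ => (norm_sum_le _ _).trans
      (Finset.sum_le_sum fun n _ => hterm m n))
  rw [Complex.norm_real] at h1
  refine (le_abs_self _).trans (h1.trans ?_)
  have h2 : ∀ m : Lattice d, (∑ n ∈ box d L, if n ∈ cube m (2 * R) then M ^ 2 else 0) ≤
      ((2 * (2 * R) + 1 : ℕ) : ℝ) ^ d * M ^ 2 := by
    intro m
    rw [← Finset.sum_filter, Finset.sum_const, nsmul_eq_mul]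
    refine mul_le_mul_of_nonneg_right ?_ (sq_nonneg M)
    rw [← Nat.cast_pow, ← card_cube m]
    exact_mod_cast Finset.card_le_card fun n hn => (Finset.mem_filter.1 hn).2
  refine (Finset.sum_le_sum fun m _ => h2 m).trans (le_of_eq ?_)
  rw [Finset.sum_const, card_box, nsmul_eq_mul, Nat.cast_pow]

theorem ae_tendsto_boxAvg_translate_zero (hd : 1 ≤ d) (hF : Measurable F) (hM : ∀ ω, ‖F ω‖ ≤ M)
    (hloc : ∀ ω ω' : Lattice d → ℝ, (∀ n ∈ cube 0 R, ω n = ω' n) → F ω = F ω')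
    (h0 : ∫ ω, F ω ∂(potentialLaw d μ) = 0) :
    ∀ᵐ ω ∂(potentialLaw d μ), Tendsto (boxAvg fun n => F (translate n ω)) atTop (𝓝 0) := by
  set C : ℝ := ((2 * (2 * R) + 1 : ℕ) : ℝ) ^ d * M ^ 2 with hC
  have hC0 : 0 ≤ C := by positivity
  have hmeas : ∀ L, Measurable fun ω => boxAvg (fun n => F (translate n ω)) L := by
    intro L
    unfold boxAvg
    exact (Finset.measurable_sum _ fun n _ => hF.comp (measurable_translate n)).div_const _
  -- the second moments along the squares are summable
  have hmom : ∀ K : ℕ, ∫⁻ ω, ENNReal.ofReal (‖boxAvg (fun n => F (translate n ω)) (K * K)‖ ^ 2)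
      ∂(potentialLaw d μ) ≤ ENNReal.ofReal (C * (1 / ((K : ℝ) + 1) ^ 2 * 4)) := by
    intro K
    have hb : ∀ ω, ‖boxAvg (fun n => F (translate n ω)) (K * K)‖ ≤ M := by
      intro ω
      rw [norm_boxAvg, div_le_iff₀ (by positivity)]
      refine (norm_sum_le _ _).trans ((Finset.sum_le_sum fun n _ => hM _).trans (le_of_eq ?_))
      rw [Finset.sum_const, card_box, nsmul_eq_mul, Nat.cast_pow, mul_comm]
    rw [← ofReal_integral_eq_lintegral_ofReal]
    · refine ENNReal.ofReal_le_ofReal ?_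
      have hN : (0 : ℝ) < ((2 * (K * K) + 1 : ℕ) : ℝ) := by exact_mod_cast Nat.succ_pos _
      simp only [norm_boxAvg, div_pow, integral_div]
      rw [div_le_iff₀ (by positivity)]
      refine (integral_norm_sq_sum_translate_le μ hF hM hloc h0 (K * K)).trans ?_
      have h1 : ((K : ℝ) + 1) ^ 2 ≤ 4 * ((2 * (K * K) + 1 : ℕ) : ℝ) ^ d := by
        have h2 : ((2 * (K * K) + 1 : ℕ) : ℝ) ≤ ((2 * (K * K) + 1 : ℕ) : ℝ) ^ d :=
          le_self_pow₀ (by exact_mod_cast Nat.succ_le_succ (Nat.zero_le _)) (by omega)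
        refine le_trans ?_ (mul_le_mul_of_nonneg_left h2 (by norm_num))
        push_cast
        nlinarith [sq_nonneg ((K : ℝ) - 1)]
      set N := ((2 * (K * K) + 1 : ℕ) : ℝ) ^ d with hNdef
      have hN0 : 0 < N := by positivity
      have h3 : 1 ≤ 1 / ((K : ℝ) + 1) ^ 2 * 4 * N := by
        rw [one_div, mul_assoc, inv_mul_eq_div, one_le_div (by positivity)]
        exact h1
      calc N * C = C * N * 1 := by ring
        _ ≤ C * N * (1 / ((K : ℝ) + 1) ^ 2 * 4 * N) :=
          mul_le_mul_of_nonneg_left h3 (by positivity)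
        _ = _ := by ring
    · refine Integrable.of_bound ((hmeas _).norm.pow_const 2).aestronglyMeasurable (M ^ 2)
        (ae_of_all _ fun ω => ?_)
      rw [Real.norm_eq_abs, abs_of_nonneg (sq_nonneg _)]
      exact pow_le_pow_left₀ (norm_nonneg _) (hb ω) 2
    · exact ae_of_all _ fun ω => sq_nonneg _
  have hfin : ∫⁻ ω, ∑' K : ℕ, ENNReal.ofReal
      (‖boxAvg (fun n => F (translate n ω)) (K * K)‖ ^ 2) ∂(potentialLaw d μ) ≠ ⊤ := by
    rw [lintegral_tsum fun K => ((hmeas _).norm.pow_const 2).ennreal_ofReal.aemeasurable]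
    refine ne_top_of_le_ne_top ?_ (ENNReal.tsum_le_tsum hmom)
    have hs : Summable fun K : ℕ => C * (1 / ((K : ℝ) + 1) ^ 2 * 4) := by
      have := (summable_nat_add_iff 1).2 (Real.summable_one_div_nat_pow.2 one_lt_two)
      push_cast at this
      exact (this.mul_right 4).mul_left C
    exact hs.tsum_ofReal_ne_top
  have hae := ae_lt_top (Measurable.tsum fun K : ℕ =>
    ((hmeas (K * K)).norm.pow_const 2).ennreal_ofReal) hfin
  filter_upwards [hae] with ω hω
  refine tendsto_boxAvg_of_squares (fun n => hM _) ?_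
  have h1 := ENNReal.tendsto_atTop_zero_of_tsum_ne_top hω.ne
  have h2 := (ENNReal.tendsto_toReal ENNReal.zero_ne_top).comp h1
  have h3 : Tendsto (fun K : ℕ => ‖boxAvg (fun n => F (translate n ω)) (K * K)‖ ^ 2) atTop
      (𝓝 0) := by
    refine h2.congr fun K => ?_
    rw [Function.comp_apply, ENNReal.toReal_ofReal (sq_nonneg _)]
  rw [tendsto_zero_iff_norm_tendsto_zero]
  simpa using h3.sqrt

/-- **Law of large numbers** for the translates of a bounded local observable. -/
theorem ae_tendsto_boxAvg_translate (hd : 1 ≤ d) (hF : Measurable F) (hM : ∀ ω, ‖F ω‖ ≤ M)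
    (hloc : ∀ ω ω' : Lattice d → ℝ, (∀ n ∈ cube 0 R, ω n = ω' n) → F ω = F ω') :
    ∀ᵐ ω ∂(potentialLaw d μ), Tendsto (boxAvg fun n => F (translate n ω)) atTop
      (𝓝 (∫ ω, F ω ∂(potentialLaw d μ))) := by
  set a := ∫ ω, F ω ∂(potentialLaw d μ) with ha
  have hint : Integrable F (potentialLaw d μ) :=
    Integrable.of_bound hF.aestronglyMeasurable M (ae_of_all _ hM)
  have h := ae_tendsto_boxAvg_translate_zero μ (F := fun ω => F ω - a) (M := M + ‖a‖) hd
    (hF.sub_const a) (fun ω => (norm_sub_le _ _).trans (by gcongr; exact hM ω))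
    (fun ω ω' h => by rw [hloc ω ω' h]) (by
      rw [integral_sub hint (integrable_const a)]
      simp [ha])
  filter_upwards [h] with ω hω
  have h1 := hω.add_const a
  rw [zero_add] at h1
  refine h1.congr fun L => ?_
  rw [boxAvg_sub, boxAvg_const, sub_add_cancel]

end LawOfLargeNumbers

end Anderson

/-! ### The normalized eigenvalue distribution of a box -/

namespace Anderson

variable {d : ℕ}

/-- The normalized trace of `exp(-itH_L)`. -/
noncomputable def traceAvg (ω : Lattice d → ℝ) (t : ℝ) (L : ℕ) : ℂ :=
  boxAvg (returnAmp (box d L) ω t) L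

/-- Extension by zero of a function on a finite set of sites. -/
noncomputable def extendZero (S : Finset (Lattice d)) : EuclideanSpace ℂ S →ₗ[ℂ] Hilb d where
  toFun v := ∑ n : S, v n • basisVec (n : Lattice d)
  map_add' v w := by simp [add_smul, Finset.sum_add_distrib]
  map_smul' c v := by simp [Finset.smul_sum, smul_smul]

theorem extendZero_apply (S : Finset (Lattice d)) (v : EuclideanSpace ℂ S) :
    extendZero S v = ∑ n : S, v n • basisVec (n : Lattice d) := rfl

theorem extendZero_coe (S : Finset (Lattice d)) (v : EuclideanSpace ℂ S) (m : S) :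
    extendZero S v (m : Lattice d) = v m := by
  rw [extendZero_apply, lp.coeFn_sum, Finset.sum_apply]
  simp [basisVec_apply]

theorem extendZero_single (S : Finset (Lattice d)) (n : S) :
    extendZero S (EuclideanSpace.single n (1 : ℂ)) = basisVec (n : Lattice d) := by
  rw [extendZero_apply, Finset.sum_eq_single n]
  · simp
  · intro m _ hm
    simp [hm]
  · simp

theorem coeFn_basisVec (n : Lattice d) : ((basisVec n : Hilb d) : Lattice d → ℂ) = Pi.single n 1 :=
  lp.coeFn_single _ _ _

theorem boxOp_extendZero (ω : Lattice d → ℝ) (L : ℕ) (v : EuclideanSpace ℂ (box d L)) :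
    boxOp (box d L) ω (extendZero (box d L) v) =
      ∑ m : box d L, ((boxMatrix ω L).mulVec v m) • basisVec (m : Lattice d) := by
  have h : ∀ n : box d L, boxOp (box d L) ω (basisVec (n : Lattice d)) =
      ∑ m : box d L, boxMatrix ω L m n • basisVec (m : Lattice d) := by
    intro n
    ext k
    rw [boxOp_apply_eq_formalOp, lp.coeFn_sum, Finset.sum_apply, coeFn_basisVec]
    · simp only [lp.coeFn_smul, Pi.smul_apply, basisVec_apply, smul_eq_mul, mul_ite, mul_one,
        mul_zero]
      split_ifs with hk
      · rw [Finset.sum_eq_single ⟨k, hk⟩]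
        · simp [boxMatrix]
        · intro m _ hm
          rw [if_neg]
          rintro rfl
          exact hm rfl
        · simp
      · refine (Finset.sum_eq_zero fun m _ => ?_).symm
        rw [if_neg]
        rintro rfl
        exact hk m.2
    · intro k hk
      rw [basisVec_apply, if_neg]
      rintro rfl
      exact hk n.2
  rw [extendZero_apply, map_sum]
  simp only [map_smul, h, Finset.smul_sum, smul_smul, Matrix.mulVec, dotProduct, Finset.sum_smul]
  rw [Finset.sum_comm]
  simp only [mul_comm]

/-- Both sides are the trace of `exp(-itH_L)`. -/
theorem sum_returnAmp_eq_sum_exp (ω : Lattice d → ℝ) (t : ℝ) (L : ℕ) :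
    ∑ n ∈ box d L, returnAmp (box d L) ω t n =
      ∑ j, Complex.exp (-(Complex.I * t * (boxMatrix_isHermitian ω L).eigenvalues j)) := by
  set S := box d L with hS
  set hM := boxMatrix_isHermitian ω L
  set v := hM.eigenvectorBasis with hv
  have heig : ∀ j, expGroup (boxOp S ω) t (extendZero S (v j)) =
      Complex.exp (-(Complex.I * t * hM.eigenvalues j)) • extendZero S (v j) := by
    intro j
    refine expGroup_apply_of_eigenvector ?_ t
    rw [boxOp_extendZero, hM.mulVec_eigenvectorBasis j, extendZero_apply, Finset.smul_sum]
    refine Finset.sum_congr rfl fun m _ => ?_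
    rw [smul_smul, Pi.smul_apply, Complex.real_smul]
  have hamp : ∀ n : S, returnAmp S ω t n = ∑ j,
      Complex.exp (-(Complex.I * t * hM.eigenvalues j)) * inner ℂ (v j n) (v j n) := by
    intro n
    have e : (basisVec (n : Lattice d) : Hilb d) =
        ∑ j, (starRingEnd ℂ) (v j n) • extendZero S (v j) := by
      rw [← extendZero_single S n, ← v.sum_repr' (EuclideanSpace.single n (1 : ℂ)), map_sum]
      refine Finset.sum_congr rfl fun j _ => ?_
      rw [map_smul, EuclideanSpace.inner_single_right, one_mul]
    rw [returnAmp, inner_basisVec_left, e, map_sum, lp.coeFn_sum, Finset.sum_apply]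
    refine Finset.sum_congr rfl fun j _ => ?_
    rw [map_smul, heig, lp.coeFn_smul, lp.coeFn_smul, Pi.smul_apply, Pi.smul_apply, extendZero_coe]
    simp only [smul_eq_mul, RCLike.inner_apply]
    ring
  rw [← Finset.sum_coe_sort, Finset.sum_congr rfl fun n _ => hamp n, Finset.sum_comm]
  refine Finset.sum_congr rfl fun j _ => ?_
  rw [← Finset.mul_sum, ← PiLp.inner_apply, inner_self_eq_norm_sq_to_K, v.norm_eq_one]
  simp

/-- The normalized eigenvalue distribution of `H_L`. -/
noncomputable def eigenDist (ω : Lattice d → ℝ) (L : ℕ) : Measure ℝ :=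
  (((2 * L + 1 : ℕ) : ℝ≥0∞) ^ d)⁻¹ •
    ∑ j, Measure.dirac ((boxMatrix_isHermitian ω L).eigenvalues j)

theorem eigenDist_Iic (ω : Lattice d → ℝ) (L : ℕ) (x : ℝ) :
    eigenDist ω L (Set.Iic x) = (eigenCount ω L x : ℝ≥0∞) / ((2 * L + 1 : ℕ) : ℝ≥0∞) ^ d := by
  rw [eigenDist, Measure.smul_apply, Measure.finsetSum_apply, smul_eq_mul, mul_comm,
    div_eq_mul_inv]
  congr 1
  simp only [Measure.dirac_apply' _ measurableSet_Iic, Set.indicator_apply, Set.mem_Iic,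
    Pi.one_apply]
  rw [Finset.sum_ite, Finset.sum_const_zero, add_zero, Finset.sum_const, nsmul_eq_mul, mul_one]
  rfl

instance (ω : Lattice d → ℝ) (L : ℕ) : IsProbabilityMeasure (eigenDist ω L) where
  measure_univ := by
    rw [eigenDist, Measure.smul_apply, Measure.finsetSum_apply]
    simp only [measure_univ, Finset.sum_const, Finset.card_univ, Fintype.card_coe, card_box,
      nsmul_eq_mul, mul_one, smul_eq_mul, Nat.cast_pow]
    refine ENNReal.inv_mul_cancel (pow_ne_zero _ (Nat.cast_ne_zero.2 (by omega))) ?_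
    exact ENNReal.pow_ne_top (ENNReal.natCast_ne_top _)

theorem charFun_eigenDist (ω : Lattice d → ℝ) (L : ℕ) (t : ℝ) :
    charFun (eigenDist ω L) (-t) = traceAvg ω t L := by
  rw [charFun_apply_real, eigenDist, integral_smul_measure, integral_finsetSum_measure]
  · simp only [integral_dirac]
    rw [traceAvg, boxAvg, sum_returnAmp_eq_sum_exp, div_eq_inv_mul, ENNReal.toReal_inv,
      ENNReal.toReal_pow, ENNReal.toReal_natCast, Complex.real_smul]
    push_cast
    congr 1
    refine Finset.sum_congr rfl fun j _ => ?_
    congr 1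
    ring
  · intro j _
    exact integrable_dirac (by simp)

end Anderson

/-! ### The density of states measure of an i.i.d. potential -/

namespace Anderson

variable {d : ℕ}

/-- The amplitude `⟪e_0, exp(-itH) e_0⟫` of returning to the origin in infinite volume. -/
noncomputable def infAmp (ω : Lattice d → ℝ) (t : ℝ) : ℂ :=
  inner ℂ (basisVec 0) (infGroup ω t (basisVec 0))

theorem norm_infAmp_le_one (ω : Lattice d → ℝ) (t : ℝ) : ‖infAmp ω t‖ ≤ 1 :=
  le_of_tendsto (tendsto_returnAmp_box ω t).norm
    (Eventually.of_forall fun _ => norm_returnAmp_le_one _ _ _ _)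

theorem measurable_infAmp (t : ℝ) : Measurable fun ω : Lattice d → ℝ => infAmp ω t :=
  measurable_of_tendsto_metrizable (fun L => measurable_returnAmp (box d L) t 0)
    (tendsto_pi_nhds.2 fun ω => tendsto_returnAmp_box ω t)

theorem norm_returnAmp_sub_infAmp_le (ω : Lattice d → ℝ) (t : ℝ) {R : ℕ} (hR : 0 < R) :
    ‖returnAmp (cube 0 R) ω t 0 - infAmp ω t‖ ≤ (2 * d * t) ^ 2 / R := by
  refine le_of_tendsto (tendsto_const_nhds.sub (tendsto_returnAmp_box ω t)).norm ?_
  filter_upwards [eventually_ge_atTop R] with L hL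
  rw [norm_sub_rev]
  refine norm_returnAmp_sub_le hR ?_ ω t
  rw [← box_eq_cube]
  exact box_subset_box hL

section

variable (μ : Measure ℝ) [IsProbabilityMeasure μ]

theorem integrable_infAmp (t : ℝ) :
    Integrable (fun ω : Lattice d → ℝ => infAmp ω t) (potentialLaw d μ) :=
  Integrable.of_bound (measurable_infAmp t).aestronglyMeasurable 1
    (ae_of_all _ fun ω => norm_infAmp_le_one ω t)

theorem integrable_returnAmp (S : Finset (Lattice d)) (t : ℝ) (n : Lattice d) :
    Integrable (fun ω : Lattice d → ℝ => returnAmp S ω t n) (potentialLaw d μ) :=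
  Integrable.of_bound (measurable_returnAmp S t n).aestronglyMeasurable 1
    (ae_of_all _ fun ω => norm_returnAmp_le_one S ω t n)

variable (d) in
/-- The mean return amplitude, which is the Fourier transform of the density of states measure. -/
noncomputable def meanAmp (t : ℝ) : ℂ := ∫ ω, infAmp ω t ∂(potentialLaw d μ)

theorem norm_integral_returnAmp_sub_meanAmp_le (t : ℝ) {R : ℕ} (hR : 0 < R) :
    ‖∫ ω, returnAmp (cube 0 R) ω t 0 ∂(potentialLaw d μ) - meanAmp d μ t‖ ≤
      (2 * d * t) ^ 2 / R := by
  rw [meanAmp, ← integral_sub (integrable_returnAmp μ _ t 0) (integrable_infAmp μ t)]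
  refine (norm_integral_le_of_norm_le_const
    (ae_of_all _ fun ω => norm_returnAmp_sub_infAmp_le ω t hR)).trans ?_
  simp

theorem tendsto_integral_returnAmp (t : ℝ) :
    Tendsto (fun R : ℕ => ∫ ω, returnAmp (cube 0 R) ω t 0 ∂(potentialLaw d μ)) atTop
      (𝓝 (meanAmp d μ t)) := by
  rw [tendsto_iff_norm_sub_tendsto_zero]
  refine squeeze_zero' (Eventually.of_forall fun _ => norm_nonneg _) ?_
    (tendsto_const_div_atTop_nhds_zero_nat ((2 * d * t) ^ 2))
  filter_upwards [eventually_gt_atTop 0] with R hR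
  exact norm_integral_returnAmp_sub_meanAmp_le μ t hR

theorem continuous_meanAmp : Continuous (meanAmp d μ) := by
  refine continuous_of_dominated (bound := fun _ => 1)
    (fun t => (measurable_infAmp t).aestronglyMeasurable)
    (fun t => ae_of_all _ fun ω => norm_infAmp_le_one ω t) (integrable_const 1)
    (ae_of_all _ fun ω => ?_)
  exact continuous_const.inner (continuous_infGroup_apply ω (basisVec 0))

end

/-- A bounded function that is small in a smaller box has a small average, up to the share of the
boundary layer. -/
theorem norm_boxAvg_le_of_interior {f : Lattice d → ℂ} {ε M : ℝ} {L L' : ℕ} (hL : L' ≤ L)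
    (hε : ∀ n ∈ box d L', ‖f n‖ ≤ ε) (hM : ∀ n, ‖f n‖ ≤ M) :
    ‖boxAvg f L‖ ≤ ε + M * (1 - (((2 * L' + 1 : ℕ) : ℝ) / ((2 * L + 1 : ℕ) : ℝ)) ^ d) := by
  have hε0 : 0 ≤ ε := (norm_nonneg _).trans (hε 0 (by rw [box_eq_cube]; exact self_mem_cube 0 L'))
  set a : ℝ := ((2 * L' + 1 : ℕ) : ℝ) with ha
  set b : ℝ := ((2 * L + 1 : ℕ) : ℝ) with hb
  have ha0 : 0 < a := by rw [ha]; exact_mod_cast Nat.succ_pos _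
  have hb0 : 0 < b := by rw [hb]; exact_mod_cast Nat.succ_pos _
  have hab : a ≤ b := by
    rw [ha, hb]
    exact_mod_cast (by omega : 2 * L' + 1 ≤ 2 * L + 1)
  rw [norm_boxAvg, div_le_iff₀ (by positivity), ← Finset.sum_sdiff (box_subset_box hL), add_comm]
  have h1 : ‖∑ n ∈ box d L', f n‖ ≤ a ^ d * ε := by
    refine (norm_sum_le _ _).trans ((Finset.sum_le_sum hε).trans (le_of_eq ?_))
    rw [Finset.sum_const, card_box, nsmul_eq_mul, Nat.cast_pow]
  have h2 : ‖∑ n ∈ box d L \ box d L', f n‖ ≤ (b ^ d - a ^ d) * M := by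
    refine (norm_sum_le _ _).trans ((Finset.sum_le_sum fun n _ => hM n).trans (le_of_eq ?_))
    rw [Finset.sum_const, Finset.card_sdiff_of_subset (box_subset_box hL), card_box, card_box,
      nsmul_eq_mul, Nat.cast_sub (Nat.pow_le_pow_left (by omega) d), Nat.cast_pow, Nat.cast_pow]
  have h3 : a ^ d * ε ≤ b ^ d * ε :=
    mul_le_mul_of_nonneg_right (pow_le_pow_left₀ ha0.le hab d) hε0
  have h4 : (1 - (a / b) ^ d) * b ^ d = b ^ d - a ^ d := by
    rw [div_pow, sub_mul, one_mul, div_mul_cancel₀ _ (by positivity)]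
  calc _ ≤ a ^ d * ε + (b ^ d - a ^ d) * M := (norm_add_le _ _).trans (add_le_add h1 h2)
    _ ≤ b ^ d * ε + (b ^ d - a ^ d) * M := by linarith
    _ = _ := by rw [← h4]; ring

theorem tendsto_side_ratio (d R : ℕ) :
    Tendsto (fun L : ℕ => 1 - (((2 * (L - R) + 1 : ℕ) : ℝ) / ((2 * L + 1 : ℕ) : ℝ)) ^ d) atTop
      (𝓝 0) := by
  have h1 : Tendsto (fun L : ℕ => ((2 * (L - R) + 1 : ℕ) : ℝ) / ((2 * L + 1 : ℕ) : ℝ)) atTop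
      (𝓝 1) := by
    have h2 : Tendsto (fun L : ℕ => 1 - (2 * R : ℝ) / ((2 * L + 1 : ℕ) : ℝ)) atTop (𝓝 (1 - 0)) := by
      refine tendsto_const_nhds.sub ((tendsto_const_div_atTop_nhds_zero_nat (2 * R : ℝ)).comp
        (tendsto_atTop_mono (fun L => ?_) tendsto_id) : _)
      simp only [id]
      omega
    rw [sub_zero] at h2
    refine h2.congr' ?_
    filter_upwards [eventually_ge_atTop R] with L hL
    have h3 : ((2 * L + 1 : ℕ) : ℝ) ≠ 0 := Nat.cast_ne_zero.2 (by omega)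
    rw [eq_div_iff h3, sub_mul, div_mul_cancel₀ _ h3]
    push_cast [Nat.cast_sub hL]
    ring
  simpa using (h1.pow d).const_sub 1

/-- Up to the sites close to the boundary, the return amplitudes in a box are those in small cubes
around each site. -/
theorem norm_traceAvg_sub_le (ω : Lattice d → ℝ) (t : ℝ) {R L : ℕ} (hR : 0 < R) (hL : R ≤ L) :
    ‖traceAvg ω t L - boxAvg (fun n => returnAmp (cube n R) ω t n) L‖ ≤ (2 * d * t) ^ 2 / R +
      2 * (1 - (((2 * (L - R) + 1 : ℕ) : ℝ) / ((2 * L + 1 : ℕ) : ℝ)) ^ d) := by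
  rw [traceAvg, ← boxAvg_sub]
  refine norm_boxAvg_le_of_interior (Nat.sub_le L R) (fun n hn => ?_) fun n => ?_
  · refine norm_returnAmp_sub_le hR ?_ ω t
    rw [box_eq_cube] at hn ⊢
    rw [mem_cube_iff_norm, Nat.cast_sub hL] at hn
    exact cube_subset_cube (by linarith)
  · refine (norm_sub_le _ _).trans ?_
    linarith [norm_returnAmp_le_one (box d L) ω t n, norm_returnAmp_le_one (cube n R) ω t n]

section

variable (μ : Measure ℝ) [IsProbabilityMeasure μ]

theorem ae_tendsto_traceAvg (hd : 1 ≤ d) (t : ℝ) :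
    ∀ᵐ ω ∂(potentialLaw d μ), Tendsto (traceAvg ω t) atTop (𝓝 (meanAmp d μ t)) := by
  have h1 : ∀ R : ℕ, ∀ᵐ ω ∂(potentialLaw d μ),
      Tendsto (boxAvg fun n => returnAmp (cube n R) ω t n) atTop
        (𝓝 (∫ ω, returnAmp (cube 0 R) ω t 0 ∂(potentialLaw d μ))) := by
    intro R
    have := ae_tendsto_boxAvg_translate μ (F := fun ω => returnAmp (cube 0 R) ω t 0) (R := R) hd
      (measurable_returnAmp _ t 0) (fun ω => norm_returnAmp_le_one _ ω t 0)
      (fun ω ω' h => returnAmp_congr h t 0)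
    filter_upwards [this] with ω hω
    rwa [show (fun n => returnAmp (cube n R) ω t n) =
      fun n => returnAmp (cube 0 R) (translate n ω) t 0 from funext fun n => returnAmp_cube n R ω t]
  filter_upwards [ae_all_iff.2 h1] with ω hω
  refine Metric.tendsto_atTop'.2 fun ε hε => ?_
  obtain ⟨R, hR⟩ := exists_nat_gt ((2 * d * t) ^ 2 / (ε / 4))
  have hR0 : (0 : ℝ) < R := lt_of_le_of_lt (by positivity) hR
  have hR0' : 0 < R := by exact_mod_cast hR0
  have hRε : (2 * d * t) ^ 2 / R < ε / 4 := by
    rwa [div_lt_comm₀ (by positivity) hR0] at hR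
  have h2 := Metric.tendsto_nhds.1 (hω R) (ε / 4) (by positivity)
  have h3 := (tendsto_order.1 ((tendsto_side_ratio d R).const_mul 2)).2 (ε / 4) (by
    rw [mul_zero]; positivity)
  obtain ⟨N, hN⟩ := eventually_atTop.1 (h2.and (h3.and (eventually_ge_atTop R)))
  refine ⟨N, fun L hL => ?_⟩
  obtain ⟨h4, h5, h6⟩ := hN L hL.le
  have h7 := norm_traceAvg_sub_le ω t hR0' h6
  have h8 := norm_integral_returnAmp_sub_meanAmp_le (d := d) μ t hR0'
  rw [← dist_eq_norm] at h7 h8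
  have h9 := dist_triangle4 (traceAvg ω t L) (boxAvg (fun n => returnAmp (cube n R) ω t n) L)
    (∫ ω, returnAmp (cube 0 R) ω t 0 ∂(potentialLaw d μ)) (meanAmp d μ t)
  linarith

/-- A modulus of continuity in time. The truncation at `2` makes the bound a bounded observable of
one site, although the potential need not have a mean. -/
theorem norm_traceAvg_time_sub_le (ω : Lattice d → ℝ) {s t δ : ℝ} (h : |s - t| ≤ δ) (L : ℕ) :
    ‖traceAvg ω s L - traceAvg ω t L‖ ≤
      ‖boxAvg (fun n => ((min 2 (δ * (2 * d + |ω n|)) : ℝ) : ℂ)) L‖ := by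
  have hδ : 0 ≤ δ := (abs_nonneg _).trans h
  rw [traceAvg, traceAvg, ← boxAvg_sub, norm_boxAvg, norm_boxAvg]
  refine div_le_div_of_nonneg_right ?_ (by positivity)
  rw [← Complex.ofReal_sum, Complex.norm_real]
  refine (norm_sum_le _ _).trans (le_trans (Finset.sum_le_sum fun n _ => ?_) (le_abs_self _))
  refine (norm_returnAmp_time_sub_le (box d L) ω s t n).trans ?_
  gcongr

theorem tendsto_integral_min :
    Tendsto (fun j : ℕ => ∫ ω : Lattice d → ℝ,
      ((min 2 (1 / ((j : ℝ) + 1) * (2 * d + |ω 0|)) : ℝ) : ℂ) ∂(potentialLaw d μ)) atTop (𝓝 0) := by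
  have h := tendsto_integral_of_dominated_convergence (μ := potentialLaw d μ)
    (F := fun (j : ℕ) (ω : Lattice d → ℝ) =>
      ((min 2 (1 / ((j : ℝ) + 1) * (2 * d + |ω 0|)) : ℝ) : ℂ)) (f := fun _ => 0) (fun _ => 2)
    (fun j => by
      refine Measurable.aestronglyMeasurable (Complex.measurable_ofReal.comp ?_)
      have : Measurable fun ω : Lattice d → ℝ => ω 0 := measurable_pi_apply 0
      fun_prop)
    (integrable_const 2)
    (fun j => ae_of_all _ fun ω => by
      rw [Complex.norm_real, Real.norm_eq_abs, abs_of_nonneg (by positivity)]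
      exact min_le_left _ _)
    (ae_of_all _ fun ω => by
      have h1 := (tendsto_one_div_add_atTop_nhds_zero_nat (𝕜 := ℝ)).mul_const (2 * d + |ω 0|)
      have h2 := (tendsto_const_nhds (x := (2 : ℝ))).min h1
      rw [zero_mul, min_eq_right (by norm_num)] at h2
      exact_mod_cast (Complex.continuous_ofReal.tendsto 0).comp h2)
  simpa using h

/-- Almost surely, the Fourier transforms of the normalized eigenvalue distributions converge for
all times simultaneously: they converge at rational times and are asymptotically equicontinuous. -/
theorem ae_forall_tendsto_traceAvg (hd : 1 ≤ d) :
    ∀ᵐ ω ∂(potentialLaw d μ), ∀ t, Tendsto (traceAvg ω t) atTop (𝓝 (meanAmp d μ t)) := by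
  have h1 : ∀ᵐ ω ∂(potentialLaw d μ), ∀ q : ℚ,
      Tendsto (traceAvg ω q) atTop (𝓝 (meanAmp d μ q)) :=
    ae_all_iff.2 fun q => ae_tendsto_traceAvg μ hd q
  have h2 : ∀ᵐ ω ∂(potentialLaw d μ), ∀ j : ℕ,
      Tendsto (boxAvg fun n => ((min 2 (1 / ((j : ℝ) + 1) * (2 * d + |ω n|)) : ℝ) : ℂ)) atTop
        (𝓝 (∫ ω : Lattice d → ℝ,
          ((min 2 (1 / ((j : ℝ) + 1) * (2 * d + |ω 0|)) : ℝ) : ℂ) ∂(potentialLaw d μ))) := by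
    refine ae_all_iff.2 fun j => ?_
    have := ae_tendsto_boxAvg_translate μ (F := fun ω : Lattice d → ℝ =>
      ((min 2 (1 / ((j : ℝ) + 1) * (2 * d + |ω 0|)) : ℝ) : ℂ)) (R := 0) (M := 2) hd
      (by
        refine Complex.measurable_ofReal.comp ?_
        have : Measurable fun ω : Lattice d → ℝ => ω 0 := measurable_pi_apply 0
        fun_prop)
      (fun ω => by
        rw [Complex.norm_real, Real.norm_eq_abs, abs_of_nonneg (by positivity)]
        exact min_le_left _ _)
      (fun ω ω' h => by rw [h 0 (self_mem_cube 0 0)])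
    simpa only [translate, zero_add] using this
  filter_upwards [h1, h2] with ω hω1 hω2 t
  refine Metric.tendsto_atTop'.2 fun ε hε => ?_
  obtain ⟨j, hj⟩ := ((Metric.tendsto_nhds.1 (tendsto_integral_min (d := d) μ)) (ε / 4)
    (by positivity)).exists
  obtain ⟨η, hη, hcont⟩ := Metric.continuousAt_iff.1
    ((continuous_meanAmp (d := d) μ).continuousAt (x := t)) (ε / 4) (by positivity)
  have hδ : (0 : ℝ) < min η (1 / ((j : ℝ) + 1)) := by positivity
  obtain ⟨q, hq1, hq2⟩ := exists_rat_btwn (lt_add_of_pos_right t hδ)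
  have hqt : |t - q| < min η (1 / ((j : ℝ) + 1)) := by
    rw [abs_lt]
    constructor <;> linarith
  have h3 := Metric.tendsto_nhds.1 (hω1 q) (ε / 4) (by positivity)
  have h4 := Metric.tendsto_nhds.1 (hω2 j) (ε / 4 - dist (∫ ω : Lattice d → ℝ,
          ((min 2 (1 / ((j : ℝ) + 1) * (2 * d + |ω 0|)) : ℝ) : ℂ) ∂(potentialLaw d μ)) 0)
          (by linarith)
  obtain ⟨N, hN⟩ := eventually_atTop.1 (h3.and h4)
  refine ⟨N, fun L hL => ?_⟩
  obtain ⟨h5, h6⟩ := hN L hL.le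
  have h7 := norm_traceAvg_time_sub_le ω (hqt.le.trans (min_le_right _ _)) L
  rw [← dist_eq_norm, ← dist_zero_right] at h7
  have h8 := dist_triangle (boxAvg (fun n => ((min 2 (1 / ((j : ℝ) + 1) * (2 * d + |ω n|)) : ℝ) : ℂ))
    L) (∫ ω : Lattice d → ℝ,
      ((min 2 (1 / ((j : ℝ) + 1) * (2 * d + |ω 0|)) : ℝ) : ℂ) ∂(potentialLaw d μ)) 0
  have h9 := hcont (x := (q : ℝ)) (by
    rw [dist_comm, Real.dist_eq]
    exact hqt.trans_le (min_le_left _ _))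
  have h10 := dist_triangle4 (traceAvg ω t L) (traceAvg ω q L) (meanAmp d μ q) (meanAmp d μ t)
  linarith

/-- The mean return amplitude is the Fourier transform of a probability measure: any weak limit
point of the eigenvalue distributions at a typical potential will do. -/
theorem exists_probabilityMeasure_charFun (hd : 1 ≤ d) :
    ∃ ν : ProbabilityMeasure ℝ, ∀ t, charFun (ν : Measure ℝ) (-t) = meanAmp d μ t := by
  obtain ⟨ω, hω⟩ := (ae_forall_tendsto_traceAvg μ hd).exists
  have hlim : ∀ t, Tendsto (fun L => charFun (eigenDist ω L) t) atTop (𝓝 (meanAmp d μ (-t))) := by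
    intro t
    refine (hω (-t)).congr fun L => ?_
    rw [← charFun_eigenDist, neg_neg]
  have htight := isTightMeasureSet_of_tendsto_charFun (μ := fun L => eigenDist ω L)
    (f := fun t => meanAmp d μ (-t))
    ((continuous_meanAmp μ).comp continuous_neg).continuousAt hlim
  let m : ℕ → ProbabilityMeasure ℝ := fun L => ⟨eigenDist ω L, inferInstance⟩
  have hcomp : IsCompact (closure (Set.range m)) := by
    refine isCompact_closure_of_isTightMeasureSet ?_
    convert htight using 1
    ext ν
    exact ⟨fun ⟨_, ⟨L, rfl⟩, h⟩ => ⟨L, h⟩, fun ⟨L, h⟩ => ⟨m L, ⟨L, rfl⟩, h⟩⟩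
  obtain ⟨ν, -, hν⟩ := hcomp.ultrafilter_le_nhds ((hyperfilter ℕ).map m)
    (le_trans (by simp) (monotone_principal subset_closure))
  refine ⟨ν, fun t => ?_⟩
  have h1 := (ProbabilityMeasure.tendsto_iff_forall_integral_rclike_tendsto ℂ).1
    (show Tendsto m (hyperfilter ℕ) (𝓝 ν) from hν) (BoundedContinuousFunction.innerProbChar (-t))
  simp only [← charFun_eq_integral_innerProbChar] at h1
  refine tendsto_nhds_unique h1 ?_
  have h2 := (hlim (-t)).mono_left Nat.hyperfilter_le_atTop
  rwa [neg_neg] at h2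

/-- If the measure whose Fourier transform is the mean return amplitude has no atoms, then it is the
density of states measure. -/
theorem isDensityOfStates_of_charFun (hd : 1 ≤ d) (ν : ProbabilityMeasure ℝ)
    (hν : ∀ t, charFun (ν : Measure ℝ) (-t) = meanAmp d μ t)
    (hatom : ∀ x, (ν : Measure ℝ) {x} = 0) : IsDensityOfStates d μ ν := by
  intro x
  filter_upwards [ae_forall_tendsto_traceAvg μ hd] with ω hω
  let m : ℕ → ProbabilityMeasure ℝ := fun L => ⟨eigenDist ω L, inferInstance⟩
  have hm : Tendsto m atTop (𝓝 ν) := by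
    refine ProbabilityMeasure.tendsto_of_tendsto_charFun fun t => ?_
    have h1 := hω (-t)
    rw [← hν, neg_neg] at h1
    refine h1.congr fun L => ?_
    rw [← charFun_eigenDist, neg_neg]
    rfl
  have h2 := ProbabilityMeasure.tendsto_measure_of_null_frontier_of_tendsto' hm
    (E := Set.Iic x) (by rw [frontier_Iic]; exact hatom x)
  refine h2.congr fun L => ?_
  exact eigenDist_Iic ω L x

/-- The density of states measure is determined by its values on half-lines. -/
theorem IsDensityOfStates.unique {ν ν' : Measure ℝ} (h : IsDensityOfStates d μ ν)
    (h' : IsDensityOfStates d μ ν') [IsProbabilityMeasure ν] : ν' = ν := by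
  have hIic : ∀ x, ν' (Set.Iic x) = ν (Set.Iic x) := by
    intro x
    obtain ⟨ω, h1, h2⟩ := ((h x).and (h' x)).exists
    exact tendsto_nhds_unique h2 h1
  have hfin : IsFiniteMeasure ν' := by
    refine ⟨?_⟩
    have h1 : Tendsto (fun n : ℕ => ν' (Set.Iic (n : ℝ))) atTop (𝓝 (ν' Set.univ)) := by
      have h2 := tendsto_measure_iUnion_atTop (μ := ν') (s := fun n : ℕ => Set.Iic (n : ℝ))
        (fun a b hab => Set.Iic_subset_Iic.2 (by exact_mod_cast hab))
      have h3 : (⋃ n : ℕ, Set.Iic (n : ℝ)) = Set.univ :=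
        Set.eq_univ_of_forall fun x => Set.mem_iUnion.2 ((exists_nat_ge x).imp fun _ h => h)
      rwa [h3] at h2
    refine lt_of_le_of_lt (le_of_tendsto' h1 fun n => ?_) ENNReal.one_lt_top
    rw [hIic]
    exact prob_le_one
  exact Measure.ext_of_Iic _ _ hIic

end

end Anderson

/-! ### The characteristic function of the Cauchy distribution -/

/-- The Fourier transform of `exp(-2π lam |x|)` is the Cauchy density. -/
theorem fourier_exp_neg_abs {lam : ℝ≥0} (hlam : 0 < lam) (w : ℝ) :
    FourierTransform.fourier (fun x : ℝ => Complex.exp (-(2 * Real.pi * lam * |x| : ℝ))) w =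
      (cauchyPDFReal 0 lam w : ℂ) := by
  have hl : (0 : ℝ) < lam := hlam
  have hpi := Real.pi_pos
  set a : ℂ := 2 * Real.pi * lam - 2 * Real.pi * w * Complex.I with ha
  set b : ℂ := -(2 * Real.pi * lam) - 2 * Real.pi * w * Complex.I with hb
  have hare : a.re = 2 * Real.pi * lam := by simp [ha]
  have hbre : b.re = -(2 * Real.pi * lam) := by simp [hb]
  have ha0 : 0 < a.re := by rw [hare]; positivity
  have hb0 : b.re < 0 := by rw [hbre]; simp only [neg_lt_zero]; positivity
  have hane : a ≠ 0 := by rintro h; rw [h] at ha0; simp at ha0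
  have hbne : b ≠ 0 := by rintro h; rw [h] at hb0; simp at hb0
  set g : ℝ → ℂ := fun v => Complex.exp (↑(-2 * Real.pi * inner ℝ v w) * Complex.I) •
    Complex.exp (-(2 * Real.pi * lam * |v| : ℝ)) with hg
  have hIic : ∀ v ∈ Set.Iic (0 : ℝ), g v = Complex.exp (a * v) := by
    intro v hv
    simp only [hg, smul_eq_mul, ← Complex.exp_add, abs_of_nonpos (Set.mem_Iic.1 hv), ha]
    congr 1
    simp
    ring
  have hIoi : ∀ v ∈ Set.Ioi (0 : ℝ), g v = Complex.exp (b * v) := by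
    intro v hv
    simp only [hg, smul_eq_mul, ← Complex.exp_add, abs_of_pos (Set.mem_Ioi.1 hv), hb]
    congr 1
    simp
    ring
  have i1 : IntegrableOn g (Set.Iic 0) :=
    (integrableOn_exp_mul_complex_Iic ha0 0).congr_fun (fun v hv => (hIic v hv).symm)
      measurableSet_Iic
  have i2 : IntegrableOn g (Set.Ioi 0) :=
    (integrableOn_exp_mul_complex_Ioi hb0 0).congr_fun (fun v hv => (hIoi v hv).symm)
      measurableSet_Ioi
  rw [Real.fourier_eq', ← intervalIntegral.integral_Iic_add_Ioi i1 i2,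
    setIntegral_congr_fun measurableSet_Iic hIic, setIntegral_congr_fun measurableSet_Ioi hIoi,
    integral_exp_mul_complex_Iic ha0, integral_exp_mul_complex_Ioi hb0, cauchyPDFReal_def]
  simp only [Complex.ofReal_zero, mul_zero, Complex.exp_zero]
  have hden : ((w : ℂ) - 0) ^ 2 + (lam : ℂ) ^ 2 ≠ 0 := by
    have : (0 : ℝ) < (w - 0) ^ 2 + (lam : ℝ) ^ 2 := by positivity
    exact_mod_cast this.ne'
  have hab : a * b = -(2 * Real.pi) ^ 2 * (((w : ℂ) - 0) ^ 2 + (lam : ℂ) ^ 2) := by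
    rw [ha, hb]
    linear_combination (2 * Real.pi * (w : ℂ)) ^ 2 * Complex.I_sq
  have hba : b - a = -(2 * (2 * Real.pi * lam)) := by rw [ha, hb]; ring
  have hpi' : (Real.pi : ℂ) ≠ 0 := by exact_mod_cast hpi.ne'
  rw [div_add_div _ _ hane hbne, hab]
  push_cast
  rw [show (1 : ℂ) * b + a * -1 = -(2 * (2 * Real.pi * lam)) by rw [← hba]; ring]
  field_simp

theorem integrable_exp_neg_abs {c : ℝ} (hc : 0 < c) :
    Integrable fun x : ℝ => Complex.exp (-(c * |x| : ℝ)) := by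
  rw [← integrableOn_univ, ← Set.Iic_union_Ioi (a := (0 : ℝ))]
  refine IntegrableOn.union ?_ ?_
  · refine (integrableOn_exp_mul_complex_Iic (a := (c : ℂ)) (by simpa) 0).congr_fun
      (fun v hv => ?_) measurableSet_Iic
    simp [abs_of_nonpos (Set.mem_Iic.1 hv)]
  · refine (integrableOn_exp_mul_complex_Ioi (a := -(c : ℂ)) (by simpa) 0).congr_fun
      (fun v hv => ?_) measurableSet_Ioi
    simp [abs_of_pos (Set.mem_Ioi.1 hv)]

theorem charFun_cauchyMeasure {lam : ℝ≥0} (hlam : 0 < lam) (t : ℝ) :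
    charFun (cauchyMeasure 0 lam) t = (Real.exp (-((lam : ℝ) * |t|)) : ℂ) := by
  have hl : (0 : ℝ) < lam := hlam
  set f : ℝ → ℂ := fun x : ℝ => Complex.exp (-(2 * Real.pi * lam * |x| : ℝ)) with hf
  have hF : FourierTransform.fourier f = fun w => (cauchyPDFReal 0 lam w : ℂ) :=
    funext (fourier_exp_neg_abs hlam)
  have hinv := Continuous.fourierInv_fourier_eq (f := f) (by fun_prop)
    (integrable_exp_neg_abs (by positivity))
    (by rw [hF]; exact (integrable_cauchyPDFReal 0).ofReal)
  have h1 := congrFun hinv (t / (2 * Real.pi))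
  rw [hF, Real.fourierInv_eq'] at h1
  rw [charFun_apply_real, cauchyMeasure_of_scale_ne_zero 0 hlam.ne',
    integral_withDensity_eq_integral_toReal_smul (measurable_cauchyPDF 0 lam)
      (ae_of_all _ fun x => ENNReal.ofReal_lt_top)]
  have h2 : f (t / (2 * Real.pi)) = (Real.exp (-((lam : ℝ) * |t|)) : ℂ) := by
    simp only [hf]
    rw [abs_div, abs_of_pos Real.two_pi_pos, Complex.ofReal_exp, Complex.ofReal_neg]
    congr 3
    field_simp
  rw [← h2, ← h1]
  congr 1
  funext x
  rw [cauchyPDF, ENNReal.toReal_ofReal (cauchyPDF_pos 0 hlam.ne' x).le, smul_eq_mul, mul_comm,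
    Complex.real_smul, mul_comm]
  congr 2
  simp
  field_simp

/-! ### The Lie–Trotter product formula for unitary groups -/

section Trotter

variable {E : Type*} [NormedAddCommGroup E] [InnerProductSpace ℂ E] [CompleteSpace E]

theorem norm_pow_sub_pow_le_of_norm_le_one {R : Type*} [NormedRing R] [NormOneClass R] {a b : R}
    (ha : ‖a‖ ≤ 1) (hb : ‖b‖ ≤ 1) (n : ℕ) : ‖a ^ n - b ^ n‖ ≤ n * ‖a - b‖ := by
  induction n with
  | zero => simp
  | succ n ih =>
    have e : a ^ (n + 1) - b ^ (n + 1) = a ^ n * (a - b) + (a ^ n - b ^ n) * b := by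
      rw [pow_succ, pow_succ]
      noncomm_ring
    rw [e]
    have h1 : ‖a ^ n‖ ≤ 1 := (norm_pow_le a n).trans (pow_le_one₀ (norm_nonneg a) ha)
    calc _ ≤ ‖a ^ n‖ * ‖a - b‖ + ‖a ^ n - b ^ n‖ * ‖b‖ :=
          (norm_add_le _ _).trans (add_le_add (norm_mul_le _ _) (norm_mul_le _ _))
      _ ≤ 1 * ‖a - b‖ + (n * ‖a - b‖) * 1 := by gcongr
      _ = _ := by push_cast; ring

/-- For bounded generators the product formula holds in norm: one step is correct to `o(t/N)`. -/
theorem tendsto_trotter [Nontrivial E] {A B : E →L[ℂ] E} (hA : IsSelfAdjoint A)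
    (hB : IsSelfAdjoint B) (t : ℝ) :
    Tendsto (fun N : ℕ => (expGroup A (t / N) * expGroup B (t / N)) ^ N) atTop
      (𝓝 (expGroup (A + B) t)) := by
  have hnorm : ∀ {C : E →L[ℂ] E}, IsSelfAdjoint C → ∀ s, ‖expGroup C s‖ ≤ 1 := fun hC s =>
    ContinuousLinearMap.opNorm_le_bound _ zero_le_one fun v => by
      rw [norm_expGroup_apply hC, one_mul]
  set G : ℝ → E →L[ℂ] E := fun s => expGroup A s * expGroup B s - expGroup (A + B) s with hG
  have hderiv : HasDerivAt G 0 0 := by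
    have := ((hasDerivAt_expGroup A 0).mul (hasDerivAt_expGroup B 0)).sub
      (hasDerivAt_expGroup (A + B) 0)
    refine this.congr_deriv ?_
    simp only [expGroup_zero, one_mul, mul_one, smul_add]
    abel
  have hG0 : G 0 = 0 := by simp [hG, expGroup_zero]
  have ho : G =o[𝓝 0] fun s : ℝ => s := by
    simpa [hG0] using hderiv.isLittleO
  have hpow : ∀ N : ℕ, N ≠ 0 → expGroup (A + B) t = expGroup (A + B) (t / N) ^ N := by
    intro N hN
    have h : ∀ k : ℕ, ∀ s : ℝ, expGroup (A + B) s ^ k = expGroup (A + B) (k * s) := by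
      intro k s
      induction k with
      | zero => simp [expGroup_zero]
      | succ k ih =>
        rw [pow_succ, ih, ← expGroup_add]
        congr 1
        push_cast
        ring
    rw [h]
    congr 1
    field_simp
  have hlim : Tendsto (fun N : ℕ => (N : ℝ) * ‖G (t / N)‖) atTop (𝓝 0) := by
    have h1 : Tendsto (fun N : ℕ => t / (N : ℝ)) atTop (𝓝 0) := tendsto_const_div_atTop_nhds_zero_nat t
    have h2 := (ho.comp_tendsto h1).norm_left
    have h3 : (fun N : ℕ => (N : ℝ) * ‖G (t / N)‖) =o[atTop] fun N : ℕ => (N : ℝ) * (t / N) :=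
      (Asymptotics.isBigO_refl (fun N : ℕ => (N : ℝ)) atTop).mul_isLittleO h2
    have h4 : (fun N : ℕ => (N : ℝ) * (t / N)) =O[atTop] fun _ => (1 : ℝ) := by
      refine Asymptotics.IsBigO.of_bound |t| (Eventually.of_forall fun N => ?_)
      rcases Nat.eq_zero_or_pos N with rfl | hN
      · simp
      · have : (N : ℝ) ≠ 0 := by positivity
        rw [mul_div_cancel₀ _ this]
        simp
    exact (Asymptotics.isLittleO_one_iff ℝ).1 (h3.trans_isBigO h4)
  rw [tendsto_iff_norm_sub_tendsto_zero]
  refine squeeze_zero' (Eventually.of_forall fun _ => norm_nonneg _) ?_ hlim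
  filter_upwards [eventually_ne_atTop 0] with N hN
  rw [hpow N hN]
  refine norm_pow_sub_pow_le_of_norm_le_one ?_ (hnorm (hA.add hB) _) N
  refine (norm_mul_le _ _).trans (mul_le_one₀ (hnorm hA _) (norm_nonneg _) (hnorm hB _))

end Trotter

/-! ### Averaging over the Cauchy part of the potential -/

namespace Anderson

variable {d : ℕ}

theorem boxOp_eq_add (S : Finset (Lattice d)) (ω : Lattice d → ℝ) :
    boxOp S ω = boxOp S 0 + diagOn S fun n => (ω n : ℂ) := by
  have : diagOn S (fun n => (((0 : Lattice d → ℝ) n : ℝ) : ℂ)) = 0 := by simp [diagOn]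
  rw [boxOp, boxOp, this, add_zero]

theorem diagOn_isSelfAdjoint (S : Finset (Lattice d)) (ω : Lattice d → ℝ) :
    IsSelfAdjoint (diagOn S fun n => (ω n : ℂ)) := star_diagOn S ω

/-- One step of the Trotter product for the evolution in a finite volume. -/
noncomputable def trotterStep (S : Finset (Lattice d)) (ω : Lattice d → ℝ) (τ : ℝ) :
    Hilb d →L[ℂ] Hilb d :=
  expGroup (boxOp S 0) τ * expGroup (diagOn S fun n => (ω n : ℂ)) τ

/-- The character `ω ↦ exp(-iτ ∑ k_x ω_x)`. -/
noncomputable def potChar (S : Finset (Lattice d)) (τ : ℝ) (k : Lattice d → ℕ)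
    (ω : Lattice d → ℝ) : ℂ :=
  ∏ x ∈ S, Complex.exp (-(Complex.I * τ * (k x * ω x)))

/-- The trigonometric polynomials in the potential that are combinations of the characters
`exp(-iτ ∑ k_x ω_x)` with `k_x ≥ 0` and `∑ k_x = N`. -/
noncomputable def potPoly (S : Finset (Lattice d)) (τ : ℝ) (N : ℕ) :
    Submodule ℂ ((Lattice d → ℝ) → ℂ) :=
  Submodule.span ℂ {f | ∃ k : Lattice d → ℕ, ∑ x ∈ S, k x = N ∧ f = potChar S τ k}

theorem mul_mem_potPoly {S : Finset (Lattice d)} {τ : ℝ} {N : ℕ} {n : Lattice d} (hn : n ∈ S)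
    {f : (Lattice d → ℝ) → ℂ} (hf : f ∈ potPoly S τ N) :
    (fun ω => Complex.exp (-(Complex.I * τ * ω n)) * f ω) ∈ potPoly S τ (N + 1) := by
  let m : ((Lattice d → ℝ) → ℂ) →ₗ[ℂ] ((Lattice d → ℝ) → ℂ) :=
    LinearMap.mulLeft ℂ fun ω => Complex.exp (-(Complex.I * τ * ω n))
  have h : potPoly S τ N ≤ (potPoly S τ (N + 1)).comap m := by
    refine Submodule.span_le.2 ?_
    rintro _ ⟨k, hk, rfl⟩
    refine Submodule.subset_span ⟨k + Pi.single n 1, ?_, ?_⟩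
    · simp [Finset.sum_add_distrib, hk, Pi.single_apply, hn]
    · funext ω
      simp only [m, LinearMap.mulLeft_apply, Pi.mul_apply, potChar]
      rw [← Finset.mul_prod_erase S _ hn, ← Finset.mul_prod_erase S _ hn, ← mul_assoc,
        ← Complex.exp_add]
      congr 1
      · congr 1
        simp
        ring
      · refine Finset.prod_congr rfl fun x hx => ?_
        simp [Finset.ne_of_mem_erase hx]
  exact h hf

/-- Each Trotter step multiplies by one phase `exp(-iτ ω_n)`, so that all the characters in the
matrix entries of the `N`-th power have total degree `N`. -/
theorem inner_trotterStep_pow_mem (S : Finset (Lattice d)) (τ : ℝ) (N : ℕ) (m : Lattice d) :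
    ∀ n ∈ S, (fun ω : Lattice d → ℝ => inner ℂ (basisVec m) ((trotterStep S ω τ ^ N)
      (basisVec n))) ∈ potPoly S τ N := by
  induction N with
  | zero =>
    intro n _
    have : (fun ω : Lattice d → ℝ => inner ℂ (basisVec m) ((trotterStep S ω τ ^ 0)
        (basisVec n))) = (inner ℂ (basisVec m) (basisVec n : Hilb d)) • potChar S τ 0 := by
      funext ω
      simp [potChar]
    rw [this]
    exact Submodule.smul_mem _ _ (Submodule.subset_span ⟨0, by simp, rfl⟩)
  | succ N ih =>
    intro n hn
    set c : Lattice d → ℂ := fun x => expGroup (boxOp S 0) τ (basisVec n) x with hc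
    have h1 : ∀ ω : Lattice d → ℝ, expGroup (diagOn S fun n => (ω n : ℂ)) τ (basisVec n) =
        Complex.exp (-(Complex.I * τ * ω n)) • basisVec n := by
      intro ω
      refine expGroup_apply_of_eigenvector ?_ τ
      ext m
      rw [diagOn_apply, lp.coeFn_smul, Pi.smul_apply, basisVec_apply]
      by_cases h : m = n
      · simp [h, hn]
      · simp [h]
    have h2 : expGroup (boxOp S 0) τ (basisVec n) = ∑ x ∈ S, c x • basisVec x := by
      rw [hc, ← diagOn_one_eq_sum]
      ext m
      rw [diagOn_apply]
      split_ifs with h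
      · simp
      · refine expGroup_boxOp_support S 0 τ (fun k hk => ?_) m h
        rw [basisVec_apply, if_neg]
        rintro rfl
        exact hk hn
    have h3 : (fun ω : Lattice d → ℝ => inner ℂ (basisVec m) ((trotterStep S ω τ ^ (N + 1))
        (basisVec n))) = ∑ x ∈ S, c x • fun ω : Lattice d → ℝ =>
          Complex.exp (-(Complex.I * τ * ω n)) *
            inner ℂ (basisVec m) ((trotterStep S ω τ ^ N) (basisVec x)) := by
      funext ω
      rw [pow_succ, mul_apply_eq_comp]
      conv_lhs => rw [trotterStep, mul_apply_eq_comp, h1, map_smul, h2, map_smul, map_sum,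
        inner_smul_right, inner_sum, ← trotterStep]
      rw [Finset.sum_apply, Finset.mul_sum]
      refine Finset.sum_congr rfl fun x _ => ?_
      rw [map_smul, inner_smul_right, Pi.smul_apply, smul_eq_mul]
      ring
    rw [h3]
    exact Submodule.sum_mem _ fun x hx => Submodule.smul_mem _ _ (mul_mem_potPoly hn (ih x hx))

theorem integral_potChar (μ : Measure ℝ) [IsProbabilityMeasure μ] (S : Finset (Lattice d)) (τ : ℝ)
    (k : Lattice d → ℕ) :
    ∫ ω, potChar S τ k ω ∂(potentialLaw d μ) = ∏ x ∈ S, charFun μ (-(τ * k x)) := by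
  have h1 : ∀ ω : Lattice d → ℝ, potChar S τ k ω = (fun η : S → ℝ =>
      ∏ x : S, Complex.exp (-(Complex.I * τ * (k x * η x)))) (S.restrict ω) := by
    intro ω
    rw [potChar, ← Finset.prod_coe_sort]
    rfl
  rw [integral_congr_ae (ae_of_all _ h1), potentialLaw]
  refine (integral_restrict_infinitePi (μ := fun _ : Lattice d => μ) (s := S)
    (f := fun η : S → ℝ => ∏ x : S, Complex.exp (-(Complex.I * τ * (k x * η x))))
    (Measurable.aestronglyMeasurable (by fun_prop))).trans ?_
  rw [integral_fintype_prod_eq_prod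
    (f := fun (x : S) (y : ℝ) => Complex.exp (-(Complex.I * τ * (k x * y)))),
    ← Finset.prod_coe_sort S fun x => charFun μ (-(τ * k x))]
  refine Finset.prod_congr rfl fun x _ => ?_
  rw [charFun_apply_real]
  congr 1
  funext y
  congr 1
  push_cast
  ring

theorem integrable_potChar (μ : Measure ℝ) [IsProbabilityMeasure μ] (S : Finset (Lattice d))
    (τ : ℝ) (k : Lattice d → ℕ) : Integrable (potChar S τ k) (potentialLaw d μ) := by
  have hm : Measurable (potChar S τ k) := by
    unfold potChar
    fun_prop
  refine Integrable.of_bound hm.aestronglyMeasurable 1 (ae_of_all _ fun ω => ?_)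
  rw [potChar, norm_prod]
  refine Finset.prod_le_one (fun _ _ => norm_nonneg _) fun x _ => ?_
  rw [Complex.norm_exp]
  simp

/-- The characteristic function of the Cauchy distribution is multiplicative in `k ≥ 0`, so that
averaging over the Cauchy part multiplies a polynomial of degree `N` by a constant. -/
theorem integral_potPoly_cauchy {lam : ℝ≥0} (hlam : 0 < lam) (μ : Measure ℝ)
    [IsProbabilityMeasure μ] (S : Finset (Lattice d)) (τ : ℝ) (N : ℕ)
    {f : (Lattice d → ℝ) → ℂ} (hf : f ∈ potPoly S τ N) :
    ∫ ω, f ω ∂(potentialLaw d (Measure.conv (cauchyMeasure 0 lam) μ)) =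
      (Real.exp (-(lam * |τ| * N)) : ℂ) * ∫ ω, f ω ∂(potentialLaw d μ) := by
  suffices h : Integrable f (potentialLaw d (Measure.conv (cauchyMeasure 0 lam) μ)) ∧
      Integrable f (potentialLaw d μ) ∧
      ∫ ω, f ω ∂(potentialLaw d (Measure.conv (cauchyMeasure 0 lam) μ)) =
        (Real.exp (-(lam * |τ| * N)) : ℂ) * ∫ ω, f ω ∂(potentialLaw d μ) from h.2.2
  induction hf using Submodule.span_induction with
  | mem f hf =>
    obtain ⟨k, hk, rfl⟩ := hf
    refine ⟨integrable_potChar _ S τ k, integrable_potChar _ S τ k, ?_⟩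
    rw [integral_potChar, integral_potChar]
    simp only [charFun_conv, Finset.prod_mul_distrib, charFun_cauchyMeasure hlam]
    congr 1
    rw [← Complex.ofReal_prod, ← Real.exp_sum]
    congr 2
    rw [← hk, Finset.sum_neg_distrib, Nat.cast_sum, Finset.mul_sum]
    congr 1
    refine Finset.sum_congr rfl fun x _ => ?_
    rw [abs_neg, abs_mul, Nat.abs_cast, mul_assoc]
  | zero => simp
  | add f g _ _ hf hg =>
    refine ⟨hf.1.add hg.1, hf.2.1.add hg.2.1, ?_⟩
    simp only [Pi.add_apply]
    rw [integral_add hf.1 hg.1, integral_add hf.2.1 hg.2.1, hf.2.2, hg.2.2, mul_add]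
  | smul c f _ hf =>
    refine ⟨hf.1.smul c, hf.2.1.smul c, ?_⟩
    simp only [Pi.smul_apply]
    rw [integral_smul, integral_smul, hf.2.2, smul_eq_mul, smul_eq_mul]
    ring

theorem tendsto_integral_trotterStep_pow (μ : Measure ℝ) [IsProbabilityMeasure μ]
    (S : Finset (Lattice d)) (t : ℝ) :
    Tendsto (fun N : ℕ => ∫ ω, inner ℂ (basisVec 0) ((trotterStep S ω (t / N) ^ N) (basisVec 0))
      ∂(potentialLaw d μ)) atTop (𝓝 (∫ ω, returnAmp S ω t 0 ∂(potentialLaw d μ))) := by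
  have : Nontrivial (Hilb d) := ⟨basisVec 0, 0, by
    rw [← norm_ne_zero_iff, norm_basisVec]; exact one_ne_zero⟩
  have hD : Continuous fun ω : Lattice d → ℝ => diagOn S fun n => (ω n : ℂ) := by
    unfold diagOn
    refine continuous_finsetSum _ fun x _ => ?_
    exact (Complex.continuous_ofReal.comp (continuous_apply x)).smul continuous_const
  have hstep : ∀ (ω : Lattice d → ℝ) (τ : ℝ) (u : Hilb d), ‖trotterStep S ω τ u‖ = ‖u‖ := by
    intro ω τ u
    rw [trotterStep, mul_apply_eq_comp, norm_expGroup_apply (boxOp_isSelfAdjoint S 0),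
      norm_expGroup_apply (diagOn_isSelfAdjoint S ω)]
  have hpow : ∀ (ω : Lattice d → ℝ) (τ : ℝ) (N : ℕ) (u : Hilb d),
      ‖(trotterStep S ω τ ^ N) u‖ = ‖u‖ := by
    intro ω τ N u
    induction N with
    | zero => simp
    | succ N ih => rw [pow_succ', mul_apply_eq_comp, hstep, ih]
  refine tendsto_integral_of_dominated_convergence (fun _ => 1) (fun N => ?_) (integrable_const 1)
    (fun N => ae_of_all _ fun ω => ?_) (ae_of_all _ fun ω => ?_)
  · refine Continuous.aestronglyMeasurable (continuous_const.inner
      (Continuous.clm_apply (Continuous.pow ?_ N) continuous_const))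
    exact continuous_const.mul (continuous_expGroup_generator hD _)
  · refine (norm_inner_le_norm _ _).trans ?_
    rw [hpow, norm_basisVec, one_mul]
  · have h := tendsto_trotter (boxOp_isSelfAdjoint S 0) (diagOn_isSelfAdjoint S ω) t
    rw [← boxOp_eq_add] at h
    exact tendsto_const_nhds.inner
      (((ContinuousLinearMap.apply ℂ (Hilb d) (basisVec 0)).continuous.tendsto _).comp h)

/-- Adding an independent Cauchy distributed term to the potential damps the mean return amplitude
by the factor `exp(-lam |t|)`. -/
theorem meanAmp_cauchy_conv {lam : ℝ≥0} (hlam : 0 < lam) (μ : Measure ℝ)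
    [IsProbabilityMeasure μ] (t : ℝ) :
    meanAmp d (Measure.conv (cauchyMeasure 0 lam) μ) t =
      (Real.exp (-(lam * |t|)) : ℂ) * meanAmp d μ t := by
  have hfin : ∀ R : ℕ, ∫ ω, returnAmp (cube 0 R) ω t 0
      ∂(potentialLaw d (Measure.conv (cauchyMeasure 0 lam) μ)) =
        (Real.exp (-(lam * |t|)) : ℂ) * ∫ ω, returnAmp (cube 0 R) ω t 0 ∂(potentialLaw d μ) := by
    intro R
    refine tendsto_nhds_unique (tendsto_integral_trotterStep_pow _ _ t) ?_
    refine ((tendsto_integral_trotterStep_pow μ (cube 0 R) t).const_mul _).congr' ?_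
    filter_upwards [eventually_ne_atTop 0] with N hN
    rw [integral_potPoly_cauchy hlam μ (cube 0 R) (t / N) N
      (inner_trotterStep_pow_mem _ _ N 0 0 (self_mem_cube 0 R))]
    congr 4
    have : (N : ℝ) ≠ 0 := by positivity
    rw [abs_div, Nat.abs_cast]
    field_simp
  refine tendsto_nhds_unique (tendsto_integral_returnAmp _ t) ?_
  exact ((tendsto_integral_returnAmp μ t).const_mul _).congr fun R => (hfin R).symm

end Anderson

/-! ### The density of states measure of the Cauchy–Anderson model -/

theorem theorem1 (d : ℕ) (hd : 1 ≤ d) (lam : ℝ≥0) (hlam : 0 < lam)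
    (μ₂ : Measure ℝ) [IsProbabilityMeasure μ₂] :
    (∃! ν : Measure ℝ,
      Anderson.IsDensityOfStates d (Measure.conv (cauchyMeasure 0 lam) μ₂) ν) ∧
    ∀ ν : Measure ℝ,
      Anderson.IsDensityOfStates d (Measure.conv (cauchyMeasure 0 lam) μ₂) ν →
      IsProbabilityMeasure ν ∧
      ∀ t : ℝ,
        Integrable (fun ω₂ : Anderson.Lattice d → ℝ =>
          inner ℂ (Anderson.basisVec (0 : Anderson.Lattice d))
            (expNegI (Anderson.hamiltonian ω₂) t (Anderson.basisVec 0)))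
          (Anderson.potentialLaw d μ₂) ∧
        ∫ x : ℝ, Complex.exp (-(Complex.I * (t : ℂ) * (x : ℂ))) ∂ν =
          (Real.exp (-((lam : ℝ) * |t|)) : ℂ) *
            ∫ ω₂ : Anderson.Lattice d → ℝ,
              inner ℂ (Anderson.basisVec (0 : Anderson.Lattice d))
                (expNegI (Anderson.hamiltonian ω₂) t (Anderson.basisVec 0))
              ∂(Anderson.potentialLaw d μ₂) := by
  set μ := Measure.conv (cauchyMeasure 0 lam) μ₂ with hμ
  obtain ⟨ν₂, hν₂⟩ := Anderson.exists_probabilityMeasure_charFun μ₂ hd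
  let ν : ProbabilityMeasure ℝ :=
    ⟨Measure.conv (cauchyMeasure 0 lam) (ν₂ : Measure ℝ), inferInstance⟩
  have hchar : ∀ t, charFun (ν : Measure ℝ) (-t) = Anderson.meanAmp d μ t := by
    intro t
    change charFun (Measure.conv (cauchyMeasure 0 lam) (ν₂ : Measure ℝ)) (-t) = _
    rw [charFun_conv, charFun_cauchyMeasure hlam, hν₂, abs_neg,
      Anderson.meanAmp_cauchy_conv hlam]
  have hac : (ν : Measure ℝ) ≪ volume := by
    change Measure.conv (cauchyMeasure 0 lam) (ν₂ : Measure ℝ) ≪ volume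
    rw [Measure.conv_comm]
    refine Measure.conv_absolutelyContinuous ?_
    rw [cauchyMeasure_of_scale_ne_zero 0 hlam.ne']
    exact withDensity_absolutelyContinuous _ _
  have hdos : Anderson.IsDensityOfStates d μ (ν : Measure ℝ) :=
    Anderson.isDensityOfStates_of_charFun μ hd ν hchar fun x => hac (by simp)
  refine ⟨⟨ν, hdos, fun ν' h' => hdos.unique μ h'⟩, fun ν' h' => ?_⟩
  obtain rfl : ν' = ν := hdos.unique μ h'
  refine ⟨inferInstance, fun t => ?_⟩
  simp only [Anderson.expNegI_hamiltonian]
  refine ⟨Anderson.integrable_infAmp μ₂ t, ?_⟩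
  have h1 := hchar t
  rw [Anderson.meanAmp_cauchy_conv hlam, charFun_apply_real] at h1
  refine Eq.trans ?_ h1
  congr 1
  funext x
  congr 1
  push_cast
  ring
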